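/- Let $X$ be a smooth $n$-dimensional manifold (Hausdorff, second countable) with a volume form $\omega$ (a nowhere vanishing smooth $n$-form). Let $K=\Omega^1(X)/d\Omega^0(X)$, where $\Omega^k(X)$ denotes the smooth real $k$-forms; diffeomorphisms $F$ act on $K$ on the right by pullback, $\alpha\mapsto\alpha(F)$, and vector fields $v$ act on $K$ by the Lie derivative, $\alpha\mapsto v\cdot\alpha$. Write $FG=F\circ G$, and write $\eta/\omega$ for the function $f$ with $\eta=f\omega$. For nowhere vanishing smooth functions $f,g$ let $C(f,g)=\ln|f|\,d\ln|g|\in K$. For diffeomorphisms $F,G$ of $X$ and vector fields $v,w$ on $X$ put $$B(F,G)=C\!\left(\frac{\omega(FG)}{\omega(G)},\frac{\omega(G)}{\omega}\right)=\ln\left|\frac{\omega(FG)}{\omega(G)}\right|\,d\ln\left|\frac{\omega(G)}{\omega}\right|\in K,\qquad c(v,w)=\operatorname{div}(v)\,d\operatorname{div}(w)\in K,$$ where $\operatorname{div}(v)=(v\cdot\omega)/\omega$. Then: 1. $B$ is a 2-cocycle on $\mathrm{Diff}(X)$ with values in the right module $K$: $B(F,G)(H)+B(FG,H)=B(F,GH)+B(G,H)$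 for all $F,G,H$. 2. $c$ is a 2-cocycle on the Lie algebra of vector fields with values in $K$: it is bilinear and alternating, and $$u\cdot c(v,w)-v\cdot c(u,w)+w\cdot c(u,v)-c([u,v],w)+c([u,w],v)-c([v,w],u)=0$$ for all vector fields $u,v,w$. 3. $c$ is the Lie algebra cocycle corresponding to the group cocycle $B$. That is, for all smooth curves $F_s$, $G_t$ of diffeomorphisms with $F_0=G_0=\mathrm{id}$ and velocities $v$, $w$ at $0$, $$c(v,w)=\frac{\partial^2}{\partial s\,\partial t}\bigg|_{s=t=0}\tfrac12\bigl(B(F_s,G_t)-B(G_t,F_s)\bigr),$$ and, even without alternation, $c(v,w)=\frac{\partial^2}{\partial s\,\partial t}\big|_{s=t=0}B(F_s,G_t)$. Here the derivative of a family in $K$ is the class of the pointwise derivative of a lift of the family to a family of one-forms depending smoothly on $(s,t)$ and the point of $X$; the existence of such a lift is part of the claim. -/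

import Mathlib

open scoped Manifold ContDiff Topology Bundle
open VectorField FiberBundle

noncomputable section

namespace VolumeManifold

section Basic

variable {n : ℕ} {X : Type*} [TopologicalSpace X]
  [ChartedSpace (EuclideanSpace ℝ (Fin n)) X]

/-! ### Smooth functions, vector fields and differential forms -/

/-- The vector field `w`, defined at all points, is smooth on a neighbourhood of `x`. -/
def SmoothNear [IsManifold (𝓡 n) ∞ X] (w : ∀ x : X, TangentSpace (𝓡 n) x) (x : X) : Prop :=
  ∀ᶠ y in 𝓝 x, ContMDiffAt (𝓡 n) (𝓡 n).tangent ∞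
    (fun y => (⟨y, w y⟩ : TangentBundle (𝓡 n) X)) y

variable (n) in
/-- The function `f` is smooth on a neighbourhood of `x`. -/
def FnSmoothNear (f : X → ℝ) (x : X) : Prop :=
  ∀ᶠ y in 𝓝 x, ContMDiffAt (𝓡 n) 𝓘(ℝ, ℝ) ∞ f y

variable (n X) in
/-- Families of alternating `k`-linear forms on the tangent spaces, without any regularity. -/
abbrev RoughForm (k : ℕ) : Type _ :=
  ∀ x : X, TangentSpace (𝓡 n) x [⋀^Fin k]→L[ℝ] ℝ

variable [IsManifold (𝓡 n) ∞ X]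

variable (n X) in
/-- The smooth differential `k`-forms: `α(w₁, …, w_k)` is smooth wherever the vector fields
`w₁, …, w_k` are smooth. -/
def smoothForms (k : ℕ) : Submodule ℝ (RoughForm n X k) where
  carrier := {α | ∀ (x : X) (w : Fin k → ∀ x : X, TangentSpace (𝓡 n) x),
    (∀ i, SmoothNear (w i) x) →
      ContMDiffAt (𝓡 n) 𝓘(ℝ, ℝ) ∞ (fun y => α y (fun i => w i y)) x}
  add_mem' := fun ha hb x w hw => (ha x w hw).add (hb x w hw)
  zero_mem' := fun _ _ _ => contMDiffAt_const
  smul_mem' := fun _ _ ha x w hw => contMDiffAt_const.mul (ha x w hw)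

variable (n X) in
/-- `Ω^k(X)`, the real vector space of smooth differential `k`-forms. -/
abbrev Form (k : ℕ) : Type _ := smoothForms n X k

instance (k : ℕ) : AddCommGroup (RoughForm n X k) := Pi.addCommGroup

instance (k : ℕ) : AddCommGroup (Form n X k) := Submodule.addCommGroup (smoothForms n X k)

instance (k : ℕ) : HasQuotient (Form n X k) (Submodule ℝ (Form n X k)) := Submodule.hasQuotient

variable (n X) in
/-- The smooth real functions on `X`. -/
abbrev SmoothFn : Type _ := C^∞⟮𝓡 n, X; 𝓘(ℝ, ℝ), ℝ⟯

variable (n X) in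
/-- The smooth vector fields on `X`. -/
abbrev VField : Type _ :=
  Cₛ^∞⟮𝓡 n; EuclideanSpace ℝ (Fin n), (TangentSpace (𝓡 n) : X → Type _)⟯

variable (n X) in
/-- The smooth diffeomorphisms of `X`. -/
abbrev Diffeo : Type _ := X ≃ₘ⟮𝓡 n, 𝓡 n⟯ X

theorem isManifold_two (n : ℕ) (X : Type*) [TopologicalSpace X]
    [ChartedSpace (EuclideanSpace ℝ (Fin n)) X] [IsManifold (𝓡 n) ∞ X] :
    IsManifold (𝓡 n) (minSmoothness ℝ 2) X := by
  rw [minSmoothness_of_isRCLikeNormedField]; infer_instance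

theorem VField.smoothNear (v : VField n X) (x : X) : SmoothNear (fun y => v y) x :=
  Filter.Eventually.of_forall v.contMDiff

theorem smoothNear_extend {x : X} (ξ : TangentSpace (𝓡 n) x) :
    SmoothNear (extend (EuclideanSpace ℝ (Fin n)) ξ) x := by
  obtain ⟨t, ht, h⟩ := exists_contMDiffOn_extend (k := ∞) (𝓡 n) (EuclideanSpace ℝ (Fin n)) ξ
  filter_upwards [eventually_mem_nhds_iff.2 ht] with y hy
  exact h.contMDiffAt hy

theorem SmoothNear.contMDiffAt {w : ∀ x : X, TangentSpace (𝓡 n) x} {x : X}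
    (h : SmoothNear w x) : ContMDiffAt (𝓡 n) (𝓡 n).tangent ∞
      (fun y => (⟨y, w y⟩ : TangentBundle (𝓡 n) X)) x :=
  h.self_of_nhds

theorem SmoothNear.mdiff {w : ∀ x : X, TangentSpace (𝓡 n) x} {x : X} (h : SmoothNear w x) :
    MDifferentiableAt (𝓡 n) (𝓡 n).tangent (fun y => (⟨y, w y⟩ : TangentBundle (𝓡 n) X)) x :=
  h.contMDiffAt.mdifferentiableAt (by simp)

theorem SmoothNear.add {v w : ∀ x : X, TangentSpace (𝓡 n) x} {x : X} (hv : SmoothNear v x)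
    (hw : SmoothNear w x) : SmoothNear (v + w) x := by
  filter_upwards [hv, hw] with y h1 h2 using h1.add_section h2

theorem SmoothNear.smul {f : X → ℝ} {w : ∀ x : X, TangentSpace (𝓡 n) x} {x : X}
    (hf : FnSmoothNear n f x) (hw : SmoothNear w x) : SmoothNear (f • w) x := by
  filter_upwards [hf, hw] with y h1 h2 using h1.smul_section h2

theorem SmoothNear.bracket {v w : ∀ x : X, TangentSpace (𝓡 n) x} {x : X} (hv : SmoothNear v x)
    (hw : SmoothNear w x) : SmoothNear (mlieBracket (𝓡 n) v w) x := by
  have : IsManifold (𝓡 n) (((⊤ : ℕ∞) : WithTop ℕ∞) + 1) X := ‹IsManifold (𝓡 n) ∞ X›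
  have := isManifold_two n X
  filter_upwards [hv, hw] with y h1 h2
  exact ContMDiffAt.mlieBracket_vectorField (m := ⊤) (n := ⊤) h1 h2 (by simp)

theorem SmoothNear.dfun {f : X → ℝ} {w : ∀ x : X, TangentSpace (𝓡 n) x} {x : X}
    (hf : ContMDiffAt (𝓡 n) 𝓘(ℝ, ℝ) ∞ f x) (hw : SmoothNear w x) :
    ContMDiffAt (𝓡 n) 𝓘(ℝ, ℝ) ∞ (fun y => mvfderiv (𝓡 n) f y (w y)) x := by
  have h1 := hf.mfderiv_const (m := ∞) (by simp)
  have h2 := ContMDiffAt.clm_apply_of_inCoordinates (b₁ := id) (b₂ := f) (v := w)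
    (ϕ := fun y => mfderiv (𝓡 n) 𝓘(ℝ, ℝ) f y) h1 hw.contMDiffAt hf
  rw [Bundle.contMDiffAt_totalSpace] at h2
  simpa using! h2.2

/-- The Lie bracket of two smooth vector fields. -/
def bracket (v w : VField n X) : VField n X :=
  ⟨mlieBracket (𝓡 n) (fun x => v x) (fun x => w x),
    fun x => ((v.smoothNear x).bracket (w.smoothNear x)).contMDiffAt⟩

/-- The action `v · f` of a vector field on functions. -/
def fnDeriv (v : VField n X) (f : SmoothFn n X) : SmoothFn n X :=
  ⟨fun x => mvfderiv (𝓡 n) f x (v x), fun x => (v.smoothNear x).dfun (f.contMDiff x)⟩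

/-- The differential `d : Ω⁰(X) → Ω¹(X)`. -/
def diff : SmoothFn n X →ₗ[ℝ] Form n X 1 where
  toFun f := ⟨fun x => ContinuousAlternatingMap.ofSubsingleton ℝ (TangentSpace (𝓡 n) x) ℝ 0
      (mvfderiv (𝓡 n) f x), fun x _ hw => (hw 0).dfun (f.contMDiff x)⟩
  map_add' f g := by
    ext x ξ
    have := mvfderiv_add (I := 𝓡 n) (f.mdifferentiableAt (x := x)) (g.mdifferentiableAt (x := x))
    simpa using! congr($this (ξ 0))
  map_smul' c f := by
    ext x ξ
    have := mvfderiv_mul (I := 𝓡 n) (mdifferentiableAt_const (c := c))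
      (f.mdifferentiableAt (x := x))
    simpa [mvfderiv_const] using! congr($this (ξ 0))

/-- The product `f α` of a function and a `k`-form. -/
def fnSmul {k : ℕ} (f : SmoothFn n X) : Form n X k →ₗ[ℝ] Form n X k where
  toFun α := ⟨fun x => f x • α.1 x, fun x w hw => (f.contMDiff x).mul (α.2 x w hw)⟩
  map_add' α β := by ext x ξ; simp
  map_smul' c α := by ext x ξ; simp; ring

/-! ### The Lie derivative -/

theorem tensorial {Φ : (∀ x : X, TangentSpace (𝓡 n) x) → ℝ} {x : X}
    (hsmul : ∀ (f : X → ℝ) (σ : ∀ x : X, TangentSpace (𝓡 n) x),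
      FnSmoothNear n f x → SmoothNear σ x → Φ (f • σ) = f x * Φ σ)
    (hadd : ∀ σ τ : ∀ x : X, TangentSpace (𝓡 n) x,
      SmoothNear σ x → SmoothNear τ x → Φ (σ + τ) = Φ σ + Φ τ)
    {σ τ : ∀ x : X, TangentSpace (𝓡 n) x} (hσ : SmoothNear σ x) (hτ : SmoothNear τ x)
    (h : σ x = τ x) : Φ σ = Φ τ := by
  classical
  have hzero : Φ 0 = 0 := by
    have := hsmul 0 0 (Filter.Eventually.of_forall fun _ => contMDiffAt_const)
      (VField.smoothNear (0 : VField n X) x)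
    simpa using this
  have hloc : ∀ {σ τ : ∀ x : X, TangentSpace (𝓡 n) x}, SmoothNear σ x → SmoothNear τ x →
      (∀ᶠ y in 𝓝 x, σ y = τ y) → Φ σ = Φ τ := by
    intro σ τ hσ hτ hστ
    let ψ : X → ℝ := fun y => if σ y = τ y then 1 else 0
    have hψx : ψ x = 1 := by simp [ψ, hστ.self_of_nhds]
    have he : ψ • σ = ψ • τ := by
      funext y
      change ψ y • σ y = ψ y • τ y
      by_cases hy : σ y = τ y
      · rw [hy]
      · simp [ψ, hy]
    have hψ : FnSmoothNear n ψ x := by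
      filter_upwards [hστ.eventually_nhds] with z hz
      exact (contMDiffAt_const (c := (1 : ℝ))).congr_of_eventuallyEq
        (hz.mono fun y hy => by simp [ψ, hy])
    have h1 := hsmul ψ σ hψ hσ
    have h2 := hsmul ψ τ hψ hτ
    rw [hψx, one_mul] at h1 h2
    rw [← h1, ← h2, he]
  let t := trivializationAt (EuclideanSpace ℝ (Fin n)) (TangentSpace (𝓡 n) : X → Type _) x
  have hx : x ∈ t.baseSet := FiberBundle.mem_baseSet_trivializationAt _ _ x
  have hxe : ∀ᶠ y in 𝓝 x, y ∈ t.baseSet := t.open_baseSet.mem_nhds hx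
  let b := (EuclideanSpace.basisFun (Fin n) ℝ).toBasis
  let s := t.localFrame b
  let c := t.localFrameCoeff (𝓡 n) b
  have hs (i) : SmoothNear (s i) x := by
    filter_upwards [hxe] with y hy
    exact contMDiffAt_localFrame_of_mem (I := 𝓡 n) ∞ t b i hy
  have hc {σ : ∀ x : X, TangentSpace (𝓡 n) x} (hσ : SmoothNear σ x) (i) :
      FnSmoothNear n (LinearMap.piApply (c i) σ) x := by
    filter_upwards [hxe, hσ] with y hy h1
    exact contMDiffAt_localFrameCoeff b hy h1 i
  have hcs {σ : ∀ x : X, TangentSpace (𝓡 n) x} (hσ : SmoothNear σ x) (i) :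
      SmoothNear ((LinearMap.piApply (c i) σ) • s i) x := (hs i).smul (hc hσ i)
  have hsum {σ : ∀ x : X, TangentSpace (𝓡 n) x} (hσ : SmoothNear σ x) (S : Finset (Fin n)) :
      SmoothNear (∑ i ∈ S, (LinearMap.piApply (c i) σ) • s i) x ∧
        Φ (∑ i ∈ S, (LinearMap.piApply (c i) σ) • s i) = ∑ i ∈ S, c i x (σ x) * Φ (s i) := by
    induction S using Finset.induction_on with
    | empty => exact ⟨VField.smoothNear (0 : VField n X) x, by simpa using hzero⟩
    | insert a S ha ih =>
      rw [Finset.sum_insert ha, Finset.sum_insert ha, hadd _ _ (hcs hσ a) ih.1, ih.2,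
        hsmul _ _ (hc hσ a) (hs a)]
      exact ⟨(hcs hσ a).add ih.1, rfl⟩
  have key {σ : ∀ x : X, TangentSpace (𝓡 n) x} (hσ : SmoothNear σ x) :
      Φ σ = ∑ i, c i x (σ x) * Φ (s i) := by
    rw [← (hsum hσ Finset.univ).2]
    refine hloc hσ (hsum hσ Finset.univ).1 ?_
    filter_upwards [t.eventually_eq_localFrame_sum_coeff_smul (I := 𝓡 n) b hx (s := σ)] with y hy
    rw [hy]
    simp [s, c, Finset.sum_apply, Pi.smul_apply']
  rw [key hσ, key hτ, h]

/-- `v · (α(w₁, …, w_k)) - ∑ i, α(w₁, …, [v, w_i], …, w_k)` at the point `x`. -/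
def lieExpr {k : ℕ} (v : VField n X) (α : RoughForm n X k)
    (w : Fin k → ∀ x : X, TangentSpace (𝓡 n) x) (x : X) : ℝ :=
  mvfderiv (𝓡 n) (fun y => α y (fun i => w i y)) x (v x)
    - ∑ i, α x (Function.update (fun j => w j x) i (mlieBracket (𝓡 n) (fun y => v y) (w i) x))

theorem form_mdiff {k : ℕ} (α : Form n X k) {w : Fin k → ∀ x : X, TangentSpace (𝓡 n) x} {x : X}
    (hw : ∀ i, SmoothNear (w i) x) :
    MDifferentiableAt (𝓡 n) 𝓘(ℝ, ℝ) (fun y => α.1 y (fun i => w i y)) x :=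
  (α.2 x w hw).mdifferentiableAt (by simp)

theorem update_apply_field {k : ℕ} (w : Fin k → ∀ x : X, TangentSpace (𝓡 n) x) (i : Fin k)
    (σ : ∀ x : X, TangentSpace (𝓡 n) x) (y : X) :
    (fun j => Function.update w i σ j y) = Function.update (fun j => w j y) i (σ y) := by
  funext j
  by_cases h : j = i
  · subst h; simp
  · simp [h]

theorem SmoothNear.update {k : ℕ} {w : Fin k → ∀ x : X, TangentSpace (𝓡 n) x} {i : Fin k}
    {σ : ∀ x : X, TangentSpace (𝓡 n) x} {x : X} (hw : ∀ j, SmoothNear (w j) x)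
    (hσ : SmoothNear σ x) : ∀ j, SmoothNear (Function.update w i σ j) x := by
  intro j
  by_cases h : j = i
  · subst h; simpa using hσ
  · simpa [h] using hw j

theorem lieExpr_update {k : ℕ} (v : VField n X) (α : RoughForm n X k)
    (w : Fin k → ∀ x : X, TangentSpace (𝓡 n) x) (i : Fin k)
    (σ : ∀ x : X, TangentSpace (𝓡 n) x) (x : X) :
    lieExpr v α (Function.update w i σ) x =
      mvfderiv (𝓡 n) (fun y => α y (Function.update (fun j => w j y) i (σ y))) x (v x)
      - (α x (Function.update (fun j => w j x) i (mlieBracket (𝓡 n) (fun y => v y) σ x))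
        + ∑ j ∈ Finset.univ.erase i, α x (Function.update (Function.update (fun j => w j x) j
            (mlieBracket (𝓡 n) (fun y => v y) (w j) x)) i (σ x))) := by
  unfold lieExpr
  rw [← Finset.add_sum_erase Finset.univ _ (Finset.mem_univ i)]
  simp only [update_apply_field, Function.update_self, Function.update_idem]
  congr 2
  refine Finset.sum_congr rfl fun j hj => ?_
  have hj : j ≠ i := Finset.ne_of_mem_erase hj
  rw [Function.update_of_ne hj, Function.update_comm hj]

theorem lieExpr_smul {k : ℕ} (v : VField n X) (α : Form n X k)
    {w : Fin k → ∀ x : X, TangentSpace (𝓡 n) x} (i : Fin k) {x : X}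
    (hw : ∀ j, SmoothNear (w j) x) (f : X → ℝ) (σ : ∀ x : X, TangentSpace (𝓡 n) x)
    (hf : FnSmoothNear n f x) (hσ : SmoothNear σ x) :
    lieExpr v α.1 (Function.update w i (f • σ)) x =
      f x * lieExpr v α.1 (Function.update w i σ) x := by
  have hf' : MDifferentiableAt (𝓡 n) 𝓘(ℝ, ℝ) f x := hf.self_of_nhds.mdifferentiableAt (by simp)
  have hα := form_mdiff α (SmoothNear.update (i := i) hw hσ)
  simp only [update_apply_field] at hα
  have := isManifold_two n X
  have h1 := mvfderiv_mul (I := 𝓡 n) hf' hα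
  rw [lieExpr_update, lieExpr_update, mlieBracket_smul_right hf' hσ.mdiff]
  have h2 : (fun y => α.1 y (Function.update (fun j => w j y) i ((f • σ) y))) =
     (f * fun y => α.1 y (Function.update (fun j => w j y) i (σ y))) := by
    funext y
    exact (α.1 y).map_update_smul _ _ _ _
  have h3 : ∀ u : Fin k → TangentSpace (𝓡 n) x,
    α.1 x (Function.update u i ((f • σ) x)) = f x * α.1 x (Function.update u i (σ x)) :=
    fun u => (α.1 x).map_update_smul _ _ _ _
  simp only [h2, h3, h1, ContinuousAlternatingMap.map_update_add,
    ContinuousAlternatingMap.map_update_smul, ← Finset.mul_sum]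
  simp
  ring

theorem lieExpr_add {k : ℕ} (v : VField n X) (α : Form n X k)
    {w : Fin k → ∀ x : X, TangentSpace (𝓡 n) x} (i : Fin k) {x : X}
    (hw : ∀ j, SmoothNear (w j) x) (σ τ : ∀ x : X, TangentSpace (𝓡 n) x)
    (hσ : SmoothNear σ x) (hτ : SmoothNear τ x) :
    lieExpr v α.1 (Function.update w i (σ + τ)) x =
      lieExpr v α.1 (Function.update w i σ) x + lieExpr v α.1 (Function.update w i τ) x := by
  have hα := form_mdiff α (SmoothNear.update (i := i) hw hσ)
  have hβ := form_mdiff α (SmoothNear.update (i := i) hw hτ)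
  simp only [update_apply_field] at hα hβ
  have := isManifold_two n X
  have h1 := mvfderiv_add (I := 𝓡 n) hα hβ
  rw [lieExpr_update, lieExpr_update, lieExpr_update, mlieBracket_add_right hσ.mdiff hτ.mdiff]
  have h3 : ∀ (y : X) (u : Fin k → TangentSpace (𝓡 n) y),
    α.1 y (Function.update u i ((σ + τ) y)) = α.1 y (Function.update u i (σ y))
      + α.1 y (Function.update u i (τ y)) :=
    fun y u => (α.1 y).map_update_add _ _ _ _
  have h2 : (fun y => α.1 y (Function.update (fun j => w j y) i ((σ + τ) y))) =
     ((fun y => α.1 y (Function.update (fun j => w j y) i (σ y))) +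
       fun y => α.1 y (Function.update (fun j => w j y) i (τ y))) := by
    funext y
    exact h3 y _
  rw [h2, h1]
  simp only [h3, ContinuousAlternatingMap.map_update_add, Finset.sum_add_distrib]
  simp
  ring

theorem lieExpr_congr {k : ℕ} (v : VField n X) (α : Form n X k)
    {w w' : Fin k → ∀ x : X, TangentSpace (𝓡 n) x} {x : X} (hw : ∀ j, SmoothNear (w j) x)
    (hw' : ∀ j, SmoothNear (w' j) x) (h : ∀ j, w j x = w' j x) :
    lieExpr v α.1 w x = lieExpr v α.1 w' x := by
  classical
  suffices H : ∀ S : Finset (Fin k),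
      (∀ j, SmoothNear (S.piecewise w' w j) x) ∧
        lieExpr v α.1 w x = lieExpr v α.1 (S.piecewise w' w) x by
    simpa using (H Finset.univ).2
  intro S
  induction S using Finset.induction_on with
  | empty => simpa using hw
  | insert a S ha ih =>
    rw [Finset.piecewise_insert]
    refine ⟨SmoothNear.update ih.1 (hw' a), ih.2.trans ?_⟩
    have := tensorial (Φ := fun σ => lieExpr v α.1 (Function.update (S.piecewise w' w) a σ) x)
      (fun f σ => lieExpr_smul v α a ih.1 f σ) (lieExpr_add v α a ih.1)
      (hw a) (hw' a) (h a)
    beta_reduce at this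
    rw [← this]
    congr 1
    conv_lhs => rw [← Function.update_eq_self a (S.piecewise w' w)]
    simp [ha]

theorem lieExpr_eq_zero {k : ℕ} (v : VField n X) (α : RoughForm n X k)
    (w : Fin k → ∀ x : X, TangentSpace (𝓡 n) x) (x : X) {i j : Fin k} (hij : i ≠ j)
    (h : w i = w j) : lieExpr v α w x = 0 := by
  unfold lieExpr
  have h1 : (fun y => α y (fun i => w i y)) = fun _ => 0 := by
    funext y
    exact (α y).map_eq_zero_of_eq _ (by simp [h]) hij
  rw [h1, mvfderiv_const]
  rw [Finset.sum_eq_add_of_mem i j (Finset.mem_univ _) (Finset.mem_univ _) hij]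
  · have h3 := (α x).toAlternatingMap.map_add_swap (Function.update (fun j => w j x) i
      (mlieBracket (𝓡 n) (fun y => v y) (w i) x)) hij
    have h4 : (Function.update (fun j => w j x) i
      (mlieBracket (𝓡 n) (fun y => v y) (w i) x)) ∘ Equiv.swap i j =
      (Function.update (fun j => w j x) j (mlieBracket (𝓡 n) (fun y => v y) (w j) x)) := by
      funext l
      by_cases hli : l = i
      · subst hli; simp [hij, hij.symm, h]
      · by_cases hlj : l = j
        · subst hlj; simp [h]
        · simp [Equiv.swap_apply_of_ne_of_ne hli hlj, hli, hlj]
    rw [h4] at h3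
    have h5 : (α x) (Function.update (fun j => w j x) i
        (mlieBracket (𝓡 n) (fun y => v y) (w i) x)) + (α x) (Function.update (fun j => w j x) j
        (mlieBracket (𝓡 n) (fun y => v y) (w j) x)) = 0 := h3
    rw [h5]
    simp
  · intro l _ hl
    exact (α x).map_eq_zero_of_eq _
      (by simp [Function.update_of_ne hl.1.symm, Function.update_of_ne hl.2.symm, h]) hij

theorem extend_update {k : ℕ} {x : X} (ξ : Fin k → TangentSpace (𝓡 n) x) (i : Fin k)
    (a : TangentSpace (𝓡 n) x) :
    (fun j => extend (EuclideanSpace ℝ (Fin n)) (Function.update ξ i a j)) =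
      Function.update (fun j => extend (EuclideanSpace ℝ (Fin n)) (ξ j)) i
        (extend (EuclideanSpace ℝ (Fin n)) a) := by
  funext j
  by_cases h : j = i
  · subst h; simp
  · simp [h]

theorem continuous_multilinear {k : ℕ} {V : Type*} [AddCommGroup V] [Module ℝ V]
    [TopologicalSpace V] [IsTopologicalAddGroup V] [ContinuousSMul ℝ V] [T2Space V]
    [FiniteDimensional ℝ V] (f : MultilinearMap ℝ (fun _ : Fin k => V) ℝ) : Continuous f := by
  let b := Module.finBasis ℝ V
  have h : (f : (Fin k → V) → ℝ) = fun ξ => ∑ r : Fin k → Fin (Module.finrank ℝ V),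
      (∏ i, b.coord (r i) (ξ i)) * f (fun i => b (r i)) := by
    funext ξ
    conv_lhs => rw [show ξ = fun i => ∑ j, b.coord j (ξ i) • b j by
      funext i; exact (b.sum_repr (ξ i)).symm]
    rw [f.map_sum]
    refine Finset.sum_congr rfl fun r _ => ?_
    rw [f.map_smul_univ, smul_eq_mul]
  rw [h]
  have (l : Fin (Module.finrank ℝ V)) : Continuous (b.coord l) :=
    LinearMap.continuous_of_finiteDimensional _
  fun_prop

/-- The value at `x` of the Lie derivative `v · α`, characterized by
`(v · α)(w₁, …, w_k) = v · (α(w₁, …, w_k)) - ∑ i, α(w₁, …, [v, w_i], …, w_k)`.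
Tangent vectors at `x` are extended to vector fields; the result does not depend on the extension
by `lieExpr_congr`. -/
def lieAt {k : ℕ} (v : VField n X) (α : Form n X k) (x : X) :
    TangentSpace (𝓡 n) x [⋀^Fin k]→L[ℝ] ℝ :=
  let f : TangentSpace (𝓡 n) x [⋀^Fin k]→ₗ[ℝ] ℝ :=
  { toFun := fun ξ => lieExpr v α.1 (fun i => extend (EuclideanSpace ℝ (Fin n)) (ξ i)) x
    map_update_add' := by
      intro inst ξ i a b
      obtain rfl : inst = instDecidableEqFin k := Subsingleton.elim _ _
      have hs := fun j => smoothNear_extend (ξ j)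
      simp only [extend_update]
      rw [← lieExpr_add v α i hs _ _ (smoothNear_extend a) (smoothNear_extend b)]
      refine lieExpr_congr v α (SmoothNear.update hs (smoothNear_extend _))
        (SmoothNear.update hs ((smoothNear_extend a).add (smoothNear_extend b))) fun j => ?_
      by_cases h : j = i
      · subst h; simp
      · simp [h]
    map_update_smul' := by
      intro inst ξ i c a
      obtain rfl : inst = instDecidableEqFin k := Subsingleton.elim _ _
      have hs := fun j => smoothNear_extend (ξ j)
      have hc : FnSmoothNear n (fun _ : X => c) x :=
        Filter.Eventually.of_forall fun _ => contMDiffAt_const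
      simp only [extend_update]
      rw [smul_eq_mul, ← lieExpr_smul v α i hs (fun _ => c) _ hc (smoothNear_extend a)]
      refine lieExpr_congr v α (SmoothNear.update hs (smoothNear_extend _))
        (SmoothNear.update hs (SmoothNear.smul hc (smoothNear_extend a))) fun j => ?_
      by_cases h : j = i
      · subst h; simp
      · simp [h]
    map_eq_zero_of_eq' := fun ξ i j h hij => lieExpr_eq_zero v α.1 _ x hij (by simp [h]) }
  { f with
    cont := by
      have : T2Space (TangentSpace (𝓡 n) x) := inferInstanceAs (T2Space (EuclideanSpace ℝ (Fin n)))
      have : FiniteDimensional ℝ (TangentSpace (𝓡 n) x) :=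
        inferInstanceAs (FiniteDimensional ℝ (EuclideanSpace ℝ (Fin n)))
      exact continuous_multilinear f.toMultilinearMap }

theorem lieAt_apply {k : ℕ} (v : VField n X) (α : Form n X k)
    {w : Fin k → ∀ x : X, TangentSpace (𝓡 n) x} {x : X} (hw : ∀ j, SmoothNear (w j) x) :
    lieAt v α x (fun i => w i x) = lieExpr v α.1 w x :=
  lieExpr_congr v α (fun _ => smoothNear_extend _) hw (by simp)

/-- The Lie derivative `v · α` of a smooth `k`-form along a smooth vector field. -/
def lieDeriv {k : ℕ} (v : VField n X) : Form n X k →ₗ[ℝ] Form n X k where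
  toFun α := ⟨fun x => lieAt v α x, by
    intro x w hw
    have h1 : (fun y => lieAt v α y (fun i => w i y)) =ᶠ[𝓝 x] lieExpr v α.1 w := by
      have : ∀ᶠ y in 𝓝 x, ∀ i, SmoothNear (w i) y :=
        Filter.eventually_all.2 fun i => (hw i).eventually_nhds
      filter_upwards [this] with y hy using lieAt_apply v α hy
    refine ContMDiffAt.congr_of_eventuallyEq ?_ h1
    refine ((v.smoothNear x).dfun (α.2 x w hw)).sub (ContMDiffAt.sum fun i _ => ?_)
    have h2 := α.2 x _ (SmoothNear.update (i := i) hw ((v.smoothNear x).bracket (hw i)))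
    simpa only [update_apply_field] using h2⟩
  map_add' α β := by
    refine Subtype.ext (funext fun x => ContinuousAlternatingMap.ext fun ξ => ?_)
    have hs := fun j => smoothNear_extend (ξ j)
    have := mvfderiv_add (I := 𝓡 n) (form_mdiff α hs) (form_mdiff β hs)
    change lieExpr v (α.1 + β.1) _ x = lieExpr v α.1 _ x + lieExpr v β.1 _ x
    unfold lieExpr
    have h2 := congr($this (v x))
    simp only [Pi.add_apply, ContinuousAlternatingMap.add_apply, Finset.sum_add_distrib]
    erw [h2]
    simp
    ring
  map_smul' c α := by
    refine Subtype.ext (funext fun x => ContinuousAlternatingMap.ext fun ξ => ?_)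
    have hs := fun j => smoothNear_extend (ξ j)
    have := mvfderiv_mul (I := 𝓡 n) (mdifferentiableAt_const (c := c)) (form_mdiff α hs)
    change lieExpr v (c • α.1) _ x = c * lieExpr v α.1 _ x
    unfold lieExpr
    have h2 := congr($this (v x))
    simp only [Pi.smul_apply, ContinuousAlternatingMap.smul_apply, smul_eq_mul, ← Finset.mul_sum]
    erw [h2]
    simp [mvfderiv_const]
    ring

theorem bracket_apply_fn (f : SmoothFn n X) {v w : ∀ x : X, TangentSpace (𝓡 n) x} {x : X}
    (hv : SmoothNear v x) (hw : SmoothNear w x) :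
    mvfderiv (𝓡 n) f x (mlieBracket (𝓡 n) v w x) =
      mvfderiv (𝓡 n) (fun y => mvfderiv (𝓡 n) f y (w y)) x (v x) -
        mvfderiv (𝓡 n) (fun y => mvfderiv (𝓡 n) f y (v y)) x (w x) := by
  let φ := extChartAt (𝓡 n) x
  let g : EuclideanSpace ℝ (Fin n) → ℝ := f ∘ φ.symm
  let P : (∀ x : X, TangentSpace (𝓡 n) x) → EuclideanSpace ℝ (Fin n) → EuclideanSpace ℝ (Fin n) :=
    fun u => mpullbackWithin 𝓘(ℝ, EuclideanSpace ℝ (Fin n)) (𝓡 n) φ.symm u (Set.range (𝓡 n))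
  have hsrc : ∀ᶠ y in 𝓝 x, y ∈ φ.source := extChartAt_source_mem_nhds x
  have hg : ∀ y ∈ φ.source, ContDiffAt ℝ ∞ g (φ y) := by
    intro y hy
    have h1 : ContMDiffAt 𝓘(ℝ, EuclideanSpace ℝ (Fin n)) (𝓡 n) ∞ φ.symm (φ y) :=
      (contMDiffOn_extChartAt_symm x).contMDiffAt
        ((isOpen_extChartAt_target x).mem_nhds (φ.map_source hy))
    exact ((f.contMDiff _).comp _ h1).contDiffAt
  have hA : ∀ y ∈ φ.source, ∀ ξ : TangentSpace (𝓡 n) y,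
      mvfderiv (𝓡 n) f y ξ = fderiv ℝ g (φ y) (mfderiv (𝓡 n) 𝓘(ℝ, EuclideanSpace ℝ (Fin n)) φ y ξ) := by
    intro y hy ξ
    have h1 : (f : X → ℝ) =ᶠ[𝓝 y] g ∘ φ := by
      filter_upwards [(isOpen_extChartAt_source x).mem_nhds hy] with z hz
      simp [g, φ.left_inv hz]
    have h2 : MDifferentiableAt 𝓘(ℝ, EuclideanSpace ℝ (Fin n)) 𝓘(ℝ, ℝ) g (φ y) :=
      ((hg y hy).differentiableAt (by simp)).mdifferentiableAt
    have h3 : MDifferentiableAt (𝓡 n) 𝓘(ℝ, EuclideanSpace ℝ (Fin n)) φ y :=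
      mdifferentiableAt_extChartAt (by simpa [φ] using hy)
    have h4 := mfderiv_comp y h2 h3
    change mfderiv (𝓡 n) 𝓘(ℝ, ℝ) f y ξ = _
    rw [h1.mfderiv_eq, h4, mfderiv_eq_fderiv]
    rfl
  have hB : ∀ u : ∀ x : X, TangentSpace (𝓡 n) x, ∀ᶠ y in 𝓝 x,
      mfderiv (𝓡 n) 𝓘(ℝ, EuclideanSpace ℝ (Fin n)) φ y (u y) = P u (φ y) := by
    intro u
    have h := eventuallyEq_mpullback_mpullbackWithin_extChartAt (I := 𝓡 n) (s := Set.univ) (x := x) u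
    rw [nhdsWithin_univ] at h
    filter_upwards [h, hsrc] with y hy hy'
    rw [hy, mpullback_apply]
    exact (isInvertible_mfderiv_extChartAt (by simpa [φ] using hy')).self_apply_inverse _
  have hP : ∀ {u : ∀ x : X, TangentSpace (𝓡 n) x}, SmoothNear u x →
      DifferentiableAt ℝ (P u) (φ x) := by
    intro u hu
    have h := hu.mdiff.mdifferentiableWithinAt (s := Set.univ)
    have := h.differentiableWithinAt_mpullbackWithin_vectorField
    have e : (extChartAt (𝓡 n) x).symm ⁻¹' Set.univ ∩ Set.range (𝓡 n) = Set.univ := by simp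
    rw [e] at this
    exact (differentiableWithinAt_univ (f := P u)).1 this
  have hd : ∀ (u u' : ∀ x : X, TangentSpace (𝓡 n) x), SmoothNear u x →
      mvfderiv (𝓡 n) (fun y => mvfderiv (𝓡 n) f y (u y)) x (u' x) =
        fderiv ℝ (fderiv ℝ g) (φ x) (P u' (φ x)) (P u (φ x)) +
          fderiv ℝ g (φ x) (fderiv ℝ (P u) (φ x) (P u' (φ x))) := by
    intro u u' hu
    have h1 : (fun y => mvfderiv (𝓡 n) f y (u y)) =ᶠ[𝓝 x]
        (fun z => fderiv ℝ g z (P u z)) ∘ φ := by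
      filter_upwards [hsrc, hB u] with y hy hy'
      rw [hA y hy, hy']
      rfl
    have hx : x ∈ φ.source := mem_extChartAt_source x
    have h5 : DifferentiableAt ℝ (fderiv ℝ g) (φ x) :=
      ((hg x hx).fderiv_right (m := ∞) (by simp)).differentiableAt (by simp)
    have h2 : DifferentiableAt ℝ (fun z => fderiv ℝ g z (P u z)) (φ x) := h5.clm_apply (hP hu)
    have h3 : MDifferentiableAt (𝓡 n) 𝓘(ℝ, EuclideanSpace ℝ (Fin n)) φ x :=
      mdifferentiableAt_extChartAt (by simp)
    have h4 := mfderiv_comp x h2.mdifferentiableAt h3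
    change mfderiv (𝓡 n) 𝓘(ℝ, ℝ) _ x (u' x) = _
    rw [h1.mfderiv_eq, h4, mfderiv_eq_fderiv]
    have h6 := (hB u').self_of_nhds
    change fderiv ℝ (fun z => fderiv ℝ g z (P u z)) (φ x)
      (mfderiv (𝓡 n) 𝓘(ℝ, EuclideanSpace ℝ (Fin n)) φ x (u' x)) = _
    rw [h6, fderiv_clm_apply h5 (hP hu)]
    simp [add_comm]
  have hx : x ∈ φ.source := mem_extChartAt_source x
  rw [hd w v hw, hd v w hv, hA x hx]
  have hsymm : fderiv ℝ (fderiv ℝ g) (φ x) (P v (φ x)) (P w (φ x)) =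
      fderiv ℝ (fderiv ℝ g) (φ x) (P w (φ x)) (P v (φ x)) :=
    ((hg x hx).isSymmSndFDerivAt (by
      rw [minSmoothness_of_isRCLikeNormedField]
      exact WithTop.coe_le_coe.2 (le_top (a := (2 : ℕ∞))))).eq _ _
  have hbr : mfderiv (𝓡 n) 𝓘(ℝ, EuclideanSpace ℝ (Fin n)) φ x (mlieBracket (𝓡 n) v w x) =
      fderiv ℝ (P w) (φ x) (P v (φ x)) - fderiv ℝ (P v) (φ x) (P w (φ x)) := by
    have e : (extChartAt (𝓡 n) x).symm ⁻¹' Set.univ ∩ Set.range (𝓡 n) = Set.univ := by simp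
    refine ((isInvertible_mfderiv_extChartAt (by simp)).self_apply_inverse _).trans ?_
    rw [e]
    exact congrFun (lieBracketWithin_univ (𝕜 := ℝ) (V := P v) (W := P w)) (φ x)
  rw [hbr, hsymm, map_sub]
  ring

theorem lieDeriv_diff (v : VField n X) (f : SmoothFn n X) :
    lieDeriv v (diff f) = diff (fnDeriv v f) := by
  refine Subtype.ext (funext fun x => ContinuousAlternatingMap.ext fun ξ => ?_)
  have hs := fun j => smoothNear_extend (ξ j)
  have h := bracket_apply_fn f (v.smoothNear x) (hs 0)
  change lieExpr v (diff f).1 _ x = _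
  unfold lieExpr
  simp [diff, fnDeriv] at h ⊢
  rw [h]
  ring_nf
  rfl

/-! ### Pullback by diffeomorphisms -/

theorem Diffeo.mfderiv_invertible (F : Diffeo n X) (x : X) :
    (mfderiv (𝓡 n) (𝓡 n) F x).IsInvertible :=
  ⟨F.mfderivToContinuousLinearEquiv (by simp) x, F.mfderivToContinuousLinearEquiv_coe (by simp)⟩

theorem Diffeo.mfderiv_apply_eq (F : Diffeo n X) (w : ∀ x : X, TangentSpace (𝓡 n) x) (y : X) :
    mfderiv (𝓡 n) (𝓡 n) F y (w y) = mpullback (𝓡 n) (𝓡 n) F.symm w (F y) := by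
  have h : mpullback (𝓡 n) (𝓡 n) F (mpullback (𝓡 n) (𝓡 n) F.symm w) y = w y := by
    have h0 : (F.symm ∘ F : X → X) = id := by funext z; simp
    have h1 := mpullbackWithin_comp_of_left (I := 𝓡 n) (I' := 𝓡 n) (I'' := 𝓡 n) (V := w)
      (g := F.symm) (f := F) (s := Set.univ) (t := Set.univ) (x₀ := y)
      (F.mdifferentiable (by simp) _).mdifferentiableWithinAt
      (fun _ _ => Set.mem_univ _) (uniqueMDiffWithinAt_univ _)
      (by simpa using Diffeo.mfderiv_invertible F.symm (F y))
    simp only [mpullbackWithin_univ, h0, mpullback_id] at h1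
    exact h1.symm
  conv_lhs => rw [← h]
  exact (Diffeo.mfderiv_invertible F y).self_apply_inverse _

/-- The right action `α ↦ α(F)` of diffeomorphisms on `k`-forms, by pullback. -/
def pullback {k : ℕ} (F : Diffeo n X) : Form n X k →ₗ[ℝ] Form n X k where
  toFun α := ⟨fun x => (α.1 (F x)).compContinuousLinearMap (mfderiv (𝓡 n) (𝓡 n) F x), by
    intro x w hw
    have h1 : ∀ i, SmoothNear (mpullback (𝓡 n) (𝓡 n) F.symm (w i)) (F x) := by
      intro i
      have h2 : ∀ᶠ z in 𝓝 (F x), ContMDiffAt (𝓡 n) (𝓡 n).tangent ∞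
          (fun y => (⟨y, w i y⟩ : TangentBundle (𝓡 n) X)) (F.symm z) :=
        F.symm.continuous.continuousAt.eventually (by
            rw [F.symm_apply_apply]
            exact hw i)
      filter_upwards [h2] with z hz
      exact ContMDiffAt.mpullback_vectorField_preimage (m := ∞) (n := ∞) hz
        F.symm.contMDiff.contMDiffAt (Diffeo.mfderiv_invertible F.symm z) (by simp)
    refine ((α.2 (F x) _ h1).comp x F.contMDiff.contMDiffAt).congr_of_eventuallyEq ?_
    refine Filter.Eventually.of_forall fun y => ?_
    simp only [ContinuousAlternatingMap.compContinuousLinearMap_apply, Function.comp_def,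
      Diffeo.mfderiv_apply_eq]⟩
  map_add' α β := rfl
  map_smul' c α := rfl

theorem pullback_diff (F : Diffeo n X) (f : SmoothFn n X) :
    pullback F (diff f) = diff (f.comp F.toContMDiffMap) := by
  refine Subtype.ext (funext fun x => ContinuousAlternatingMap.ext fun ξ => ?_)
  have h := mvfderiv_comp_apply x (f.mdifferentiableAt (x := F x))
    (F.mdifferentiable (by simp) x) (ξ 0)
  exact h.symm

/-! ### Volume forms and quotients of top-degree forms -/

variable (n X) in
/-- A volume form on the `n`-dimensional manifold `X`: a nowhere vanishing smooth `n`-form. -/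
structure VolumeForm where
  /-- The underlying `n`-form. -/
  form : Form n X n
  ne_zero : ∀ x, form.1 x ≠ 0

variable (n X) in
/-- `Map(X, ℝ*)`: the nowhere vanishing smooth functions. -/
structure NonvanishingFn where
  /-- The underlying function. -/
  fn : SmoothFn n X
  ne_zero : ∀ x, fn x ≠ 0

/-- The standard basis of `ℝⁿ`, seen as a basis of the tangent space at `x`. -/
def tangentBasis (x : X) : Module.Basis (Fin n) ℝ (TangentSpace (𝓡 n) x) :=
  (EuclideanSpace.basisFun (Fin n) ℝ).toBasis

theorem top_basis_ne_zero {x : X} {vol : TangentSpace (𝓡 n) x [⋀^Fin n]→L[ℝ] ℝ} (h : vol ≠ 0)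
    (b : Module.Basis (Fin n) ℝ (TangentSpace (𝓡 n) x)) : vol b ≠ 0 := by
  intro h0
  apply h
  have := (b.ext_alternating (f := vol.toAlternatingMap) (g := 0) fun r hr => ?_)
  · ext ξ
    exact congr($this ξ)
  · let σ : Equiv.Perm (Fin n) := Equiv.ofBijective r (Finite.injective_iff_bijective.1 hr)
    have h1 := vol.toAlternatingMap.map_perm b σ
    have h2 : vol.toAlternatingMap b = 0 := h0
    rw [h2, smul_zero] at h1
    exact h1

theorem top_proportional {x : X} (η vol : TangentSpace (𝓡 n) x [⋀^Fin n]→L[ℝ] ℝ)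
    (b : Module.Basis (Fin n) ℝ (TangentSpace (𝓡 n) x)) (ξ : Fin n → TangentSpace (𝓡 n) x) :
    η ξ * vol b = η b * vol ξ := by
  have h1 : η ξ = η b * b.det ξ := congr($(η.toAlternatingMap.eq_smul_basis_det b) ξ)
  have h2 : vol ξ = vol b * b.det ξ := congr($(vol.toAlternatingMap.eq_smul_basis_det b) ξ)
  rw [h1, h2]
  ring

/-- The quotient `η / ω` of a top-degree form by a volume form, as a smooth function. -/
def topQuot (η : Form n X n) (vol : VolumeForm n X) : SmoothFn n X :=
  ⟨fun x => η.1 x (tangentBasis x) / vol.form.1 x (tangentBasis x), by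
    intro x
    let t := trivializationAt (EuclideanSpace ℝ (Fin n)) (TangentSpace (𝓡 n) : X → Type _) x
    have hx : x ∈ t.baseSet := FiberBundle.mem_baseSet_trivializationAt _ _ x
    have hxe : ∀ᶠ y in 𝓝 x, y ∈ t.baseSet := t.open_baseSet.mem_nhds hx
    let b := (EuclideanSpace.basisFun (Fin n) ℝ).toBasis
    have hs (i) : SmoothNear (t.localFrame b i) x := by
      filter_upwards [hxe] with y hy
      exact contMDiffAt_localFrame_of_mem (I := 𝓡 n) ∞ t b i hy
    have hb : ∀ y (hy : y ∈ t.baseSet), (fun i => t.localFrame b i y) = t.basisAt b hy := by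
      intro y hy
      funext i
      exact t.localFrame_apply_of_mem_baseSet b hy
    have h0 : vol.form.1 x (fun i => t.localFrame b i x) ≠ 0 := by
      rw [hb x hx]
      exact top_basis_ne_zero (vol.ne_zero x) _
    refine ((η.2 x _ hs).div₀ (vol.form.2 x _ hs) h0).congr_of_eventuallyEq ?_
    filter_upwards [hxe] with y hy
    rw [Pi.div_apply, hb y hy, div_eq_div_iff (top_basis_ne_zero (vol.ne_zero y) _)
      (top_basis_ne_zero (vol.ne_zero y) _)]
    exact (top_proportional _ _ (t.basisAt b hy) _).trans (by rfl)⟩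

theorem topQuot_spec (η : Form n X n) (vol : VolumeForm n X) :
    η = fnSmul (topQuot η vol) vol.form := by
  refine Subtype.ext (funext fun x => ContinuousAlternatingMap.ext fun ξ => ?_)
  change η.1 x ξ = η.1 x (tangentBasis x) / vol.form.1 x (tangentBasis x) * vol.form.1 x ξ
  have h := top_basis_ne_zero (vol.ne_zero x) (tangentBasis x)
  have h1 := top_proportional (η.1 x) (vol.form.1 x) (tangentBasis x) ξ
  field_simp
  linarith

/-- The quotient `ω' / ω` of two volume forms. -/
def volQuot (vol' vol : VolumeForm n X) : NonvanishingFn n X :=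
  ⟨topQuot vol'.form vol, fun x => div_ne_zero (top_basis_ne_zero (vol'.ne_zero x) _)
    (top_basis_ne_zero (vol.ne_zero x) _)⟩

/-- The pullback `ω(F)` of a volume form by a diffeomorphism. -/
def VolumeForm.pull (vol : VolumeForm n X) (F : Diffeo n X) : VolumeForm n X :=
  ⟨pullback F vol.form, by
    intro x h
    apply vol.ne_zero (F x)
    ext ξ
    have h1 := congr($h fun i => (F.mfderivToContinuousLinearEquiv (by simp) x).symm (ξ i))
    have h2 : (fun i => mfderiv (𝓡 n) (𝓡 n) F x
        ((F.mfderivToContinuousLinearEquiv (by simp) x).symm (ξ i))) = ξ := by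
      funext i
      exact (F.mfderivToContinuousLinearEquiv (by simp) x).apply_symm_apply (ξ i)
    have h3 : vol.form.1 (F x) (fun i => mfderiv (𝓡 n) (𝓡 n) F x
        ((F.mfderivToContinuousLinearEquiv (by simp) x).symm (ξ i))) = 0 := h1
    rw [h2] at h3
    exact h3⟩

/-- The function `ln |f|`. -/
def lnAbs (f : NonvanishingFn n X) : SmoothFn n X :=
  ⟨fun x => Real.log |f.fn x|, by
    intro x
    simp only [Real.log_abs]
    exact (Real.contDiffAt_log.2 (f.ne_zero x)).contMDiffAt.comp x (f.fn.contMDiff x)⟩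

/-- The divergence `div v = (v · ω) / ω` of a vector field. -/
def divergence (vol : VolumeForm n X) (v : VField n X) : SmoothFn n X :=
  topQuot (lieDeriv v vol.form) vol

/-! ### The module `Ω¹ / dΩ⁰` and the cocycles -/

variable (n X) in
/-- `Ω¹(X) / dΩ⁰(X)`. -/
abbrev K : Type _ := Form n X 1 ⧸ LinearMap.range (diff (n := n) (X := X))

/-- The class of a one-form in `Ω¹(X) / dΩ⁰(X)`. -/
def cls : Form n X 1 →ₗ[ℝ] K n X := Submodule.mkQ _

/-- The right action of diffeomorphisms on `Ω¹(X) / dΩ⁰(X)`, induced by pullback. -/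
def pullK (F : Diffeo n X) : K n X →ₗ[ℝ] K n X :=
  Submodule.mapQ _ _ (pullback F) (by
    rintro _ ⟨f, rfl⟩
    exact ⟨_, (pullback_diff F f).symm⟩)

/-- The action of vector fields on `Ω¹(X) / dΩ⁰(X)`, induced by the Lie derivative. -/
def lieK (v : VField n X) : K n X →ₗ[ℝ] K n X :=
  Submodule.mapQ _ _ (lieDeriv v) (by
    rintro _ ⟨f, rfl⟩
    exact ⟨_, (lieDeriv_diff v f).symm⟩)

/-- The Heisenberg cocycle `C(f, g) = ln|f| d ln|g|` on `Map(X, ℝ*)`. -/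
def heisenberg (f g : NonvanishingFn n X) : K n X :=
  cls (fnSmul (lnAbs f) (diff (lnAbs g)))

/-- The product `FG` in the group of diffeomorphisms: `(FG)(x) = F(G(x))`. -/
def comp (F G : Diffeo n X) : Diffeo n X := G.trans F

/-- `B(F, G) = C(ω(FG)/ω(G), ω(G)/ω) = ln|ω(FG)/ω(G)| d ln|ω(G)/ω|` in `Ω¹(X) / dΩ⁰(X)`. -/
def groupCocycle (vol : VolumeForm n X) (F G : Diffeo n X) : K n X :=
  heisenberg (volQuot (vol.pull (comp F G)) (vol.pull G)) (volQuot (vol.pull G) vol)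

/-- `c(v, w) = div(v) d div(w)` in `Ω¹(X) / dΩ⁰(X)`. -/
def lieCocycle (vol : VolumeForm n X) (v w : VField n X) : K n X :=
  cls (fnSmul (divergence vol v) (diff (divergence vol w)))

/-- `b` is an abelian 2-cocycle on the group of diffeomorphisms with values in the right module
`Ω¹(X) / dΩ⁰(X)`. -/
def IsGroupCocycle (b : Diffeo n X → Diffeo n X → K n X) : Prop :=
  ∀ F G H : Diffeo n X,
    pullK H (b F G) + b (comp F G) H = b F (comp G H) + b G H

/-- `c` is a 2-cocycle on the Lie algebra of vector fields with values in the module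
`Ω¹(X) / dΩ⁰(X)`: it is bilinear, alternating, and its Chevalley-Eilenberg differential
vanishes. -/
structure IsLieCocycle (c : VField n X → VField n X → K n X) : Prop where
  add_left : ∀ v v' w, c (v + v') w = c v w + c v' w
  smul_left : ∀ (a : ℝ) v w, c (a • v) w = a • c v w
  add_right : ∀ v w w', c v (w + w') = c v w + c v w'
  smul_right : ∀ (a : ℝ) v w, c v (a • w) = a • c v w
  alternating : ∀ v, c v v = 0
  differential : ∀ u v w,
    lieK u (c v w) - lieK v (c u w) + lieK w (c u v)
      - c (bracket u v) w + c (bracket u w) v - c (bracket v w) u = 0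

/-! ### Passing from the group to the Lie algebra -/

/-- `F` is a smooth curve of diffeomorphisms through the identity, with velocity `v` at the
identity. -/
structure IsCurve (F : ℝ → Diffeo n X) (v : VField n X) : Prop where
  smooth : ContMDiff (𝓘(ℝ, ℝ).prod (𝓡 n)) (𝓡 n) ∞ (fun p : ℝ × X => F p.1 p.2)
  zero : F 0 = Diffeomorph.refl (𝓡 n) X ∞
  velocity : ∀ x, HasMFDerivAt 𝓘(ℝ, ℝ) (𝓡 n) (fun s => F s x) 0
    ((1 : ℝ →L[ℝ] ℝ).smulRight (v (F 0 x)))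

/-- A two-parameter family of one-forms on `X` which is smooth in the parameters and in the point
jointly. -/
def IsSmoothFamily (β : ℝ → ℝ → Form n X 1) : Prop :=
  ∀ (s t : ℝ) (x : X) (w : Fin 1 → ∀ x : X, TangentSpace (𝓡 n) x), (∀ i, SmoothNear (w i) x) →
    ContMDiffAt ((𝓘(ℝ, ℝ).prod 𝓘(ℝ, ℝ)).prod (𝓡 n)) 𝓘(ℝ, ℝ) ∞
      (fun p : (ℝ × ℝ) × X => (β p.1.1 p.1.2).1 p.2 (fun i => w i p.2)) ((s, t), x)

/-- The two-parameter family `b` in `Ω¹(X) / dΩ⁰(X)` is smooth, in the sense that it lifts to a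
smooth family of one-forms, and `κ` is its mixed second derivative `∂²b/∂s∂t` at `s = t = 0`.
(The derivative of a smooth family of one-forms is taken at each point of `X`; its class does not
depend on the lift, because a smooth family of exact forms has exact derivatives.) -/
def HasMixedDeriv (b : ℝ → ℝ → K n X) (κ : K n X) : Prop :=
  ∃ β : ℝ → ℝ → Form n X 1, IsSmoothFamily β ∧ (∀ s t, cls (β s t) = b s t) ∧
    ∃ γ : Form n X 1, cls γ = κ ∧ ∀ (x : X) (ξ : Fin 1 → TangentSpace (𝓡 n) x),
      deriv (fun s => deriv (fun t => (β s t).1 x ξ) 0) 0 = γ.1 x ξ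

/-- The Lie algebra 2-cochain `c` corresponds to the group 2-cochain `b`:
`c(v, w)` is the alternation `½ (D²b(v, w) - D²b(w, v))` of the second derivative of `b` at the
identity, that is `c(v, w) = ∂²/∂s∂t ½ (b(F_s, G_t) - b(G_t, F_s))` at `s = t = 0` for all smooth
curves `F_s`, `G_t` of diffeomorphisms through the identity with velocities `v`, `w`. -/
def Corresponds (b : Diffeo n X → Diffeo n X → K n X) (c : VField n X → VField n X → K n X) :
    Prop :=
  ∀ (v w : VField n X) (F G : ℝ → Diffeo n X), IsCurve F v → IsCurve G w →
    HasMixedDeriv (fun s t => (1 / 2 : ℝ) • (b (F s) (G t) - b (G t) (F s))) (c v w)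

end Basic

end VolumeManifold

end

/-!
For a diffeomorphism `F` let `a_F = ln |ω(F) / ω|` be its logarithmic Jacobian (`logJac`). The chain
rule gives `ln |ω(FG) / ω(G)| = a_F ∘ G`, hence `a_{FG} = a_F ∘ G + a_G`, and `B(F, G)` is the class
of the one-form `(a_F ∘ G) d a_G` (`cocycleForm`). With this the group cocycle identity is bilinear
algebra and holds already for one-forms.

On the Lie algebra side `[L_u, L_v] = L_{[u, v]}` on forms of all degrees (`lieDeriv_bracket`, from
the Jacobi identity), so `div [u, v] = u · div v - v · div u` (`divergence_bracket`). Since `v` acts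
on `f dg` by `(v · f) dg + f d(v · g)`, the cocycle identity follows by integration by parts: the
class of `f dg` is minus the class of `g df` (`cls_fnSmul_diff_swap`).

For a smooth curve `F_s` of diffeomorphisms, the Jacobian is computed in charts as the determinant
of the differential of `F_s` times a quotient of coefficients of `ω`. This shows that `a_{F_s}(x)`
is smooth in `(s, x)` (`contMDiff_logJac`), so that `(a_{F_s} ∘ G_t) d a_{G_t}` is a smooth lift of
`B(F_s, G_t)`; and, after interchanging the derivative in `s` with the differential on `X`
(`hasDerivAt_mvfderiv_family`), that the derivative of `a_{F_s}` at `s = 0` is `div v`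
(`IsCurve.hasDerivAt_logJac`). As `a_id = 0`, the product rule gives the mixed derivatives
`div v d div w` for `B(F_s, G_t)` and `div w d div v` for `B(G_t, F_s)`, and the classes of these two
forms are opposite.
-/

noncomputable section

namespace VolumeManifold

variable {n : ℕ} {X : Type*} [TopologicalSpace X]
  [ChartedSpace (EuclideanSpace ℝ (Fin n)) X] [IsManifold (𝓡 n) ∞ X]

/-! ### Functions and forms -/

theorem Form.ext' {k : ℕ} {α β : Form n X k} (h : ∀ x ξ, α.1 x ξ = β.1 x ξ) : α = β :=
  Subtype.ext (funext fun x => ContinuousAlternatingMap.ext fun ξ => h x ξ)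

theorem fnSmul_apply {k : ℕ} (f : SmoothFn n X) (α : Form n X k) (x : X)
    (ξ : Fin k → TangentSpace (𝓡 n) x) : (fnSmul f α).1 x ξ = f x * α.1 x ξ := rfl

theorem fnSmul_add {k : ℕ} (f g : SmoothFn n X) (α : Form n X k) :
    fnSmul (f + g) α = fnSmul f α + fnSmul g α :=
  Form.ext' fun x ξ => add_mul (f x) (g x) (α.1 x ξ)

theorem fnSmul_const_smul {k : ℕ} (c : ℝ) (f : SmoothFn n X) (α : Form n X k) :
    fnSmul (c • f) α = c • fnSmul f α :=
  Form.ext' fun x ξ => mul_assoc c (f x) (α.1 x ξ)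

theorem diff_mul (f g : SmoothFn n X) :
    diff (f * g) = fnSmul f (diff g) + fnSmul g (diff f) := by
  refine Form.ext' fun x ξ => ?_
  have h := mvfderiv_mul (I := 𝓡 n) (f.mdifferentiableAt (x := x)) (g.mdifferentiableAt (x := x))
  exact congr($h (ξ 0))

/-- Integration by parts in `Ω¹ / dΩ⁰`: the class of `f dg` is antisymmetric in `f` and `g`. -/
theorem cls_fnSmul_diff_swap (f g : SmoothFn n X) :
    cls (fnSmul f (diff g)) = -cls (fnSmul g (diff f)) := by
  rw [eq_neg_iff_add_eq_zero, ← map_add, ← diff_mul]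
  exact (Submodule.Quotient.mk_eq_zero _).2 ⟨_, rfl⟩

theorem cls_fnSmul_diff_self (f : SmoothFn n X) : cls (fnSmul f (diff f)) = 0 := by
  refine (Submodule.Quotient.mk_eq_zero _).2 ⟨(1 / 2 : ℝ) • (f * f), ?_⟩
  rw [map_smul, diff_mul, ← two_smul ℝ, smul_smul]
  norm_num

/-! ### The group cocycle -/

theorem pullback_comp {k : ℕ} (F G : Diffeo n X) (α : Form n X k) :
    pullback (comp F G) α = pullback G (pullback F α) := by
  refine Form.ext' fun x ξ => ?_
  have h : mfderiv (𝓡 n) (𝓡 n) (comp F G) x =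
      (mfderiv (𝓡 n) (𝓡 n) F (G x)).comp (mfderiv (𝓡 n) (𝓡 n) G x) :=
    mfderiv_comp x (F.mdifferentiable (by simp) _) (G.mdifferentiable (by simp) _)
  change α.1 (F (G x)) (fun i => mfderiv (𝓡 n) (𝓡 n) (comp F G) x (ξ i)) = _
  rw [h]
  rfl

theorem pullback_fnSmul {k : ℕ} (F : Diffeo n X) (f : SmoothFn n X) (α : Form n X k) :
    pullback F (fnSmul f α) = fnSmul (f.comp F.toContMDiffMap) (pullback F α) := rfl

/-- The quotient `η / ω` is the only function `f` with `η = f ω`. -/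
theorem topQuot_eq {η : Form n X n} {vol : VolumeForm n X} {f : SmoothFn n X}
    (h : η = fnSmul f vol.form) : topQuot η vol = f := by
  ext x
  rw [h]
  exact mul_div_cancel_right₀ _ (top_basis_ne_zero (vol.ne_zero x) _)

/-- The logarithmic Jacobian `ln |ω(F) / ω|` of a diffeomorphism. -/
def logJac (vol : VolumeForm n X) (F : Diffeo n X) : SmoothFn n X :=
  lnAbs (volQuot (vol.pull F) vol)

/-- The chain rule `ω(FG) / ω(G) = (ω(F) / ω) ∘ G` for Jacobians. -/
theorem volQuot_pull_comp (vol : VolumeForm n X) (F G : Diffeo n X) :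
    (volQuot (vol.pull (comp F G)) (vol.pull G)).fn =
      (volQuot (vol.pull F) vol).fn.comp G.toContMDiffMap := by
  refine topQuot_eq ?_
  change pullback (comp F G) vol.form = fnSmul _ (pullback G vol.form)
  rw [pullback_comp, ← pullback_fnSmul]
  exact congrArg (pullback G) (topQuot_spec _ vol)

theorem lnAbs_volQuot_pull_comp (vol : VolumeForm n X) (F G : Diffeo n X) :
    lnAbs (volQuot (vol.pull (comp F G)) (vol.pull G)) =
      (logJac vol F).comp G.toContMDiffMap := by
  ext x
  have h : (volQuot (vol.pull (comp F G)) (vol.pull G)).fn x =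
      (volQuot (vol.pull F) vol).fn (G x) := congr($(volQuot_pull_comp vol F G) x)
  change Real.log |(volQuot (vol.pull (comp F G)) (vol.pull G)).fn x| = _
  rw [h]
  rfl

/-- The one-form `ln |ω(FG) / ω(G)| d ln |ω(G) / ω|` representing `B(F, G)`. -/
def cocycleForm (vol : VolumeForm n X) (F G : Diffeo n X) : Form n X 1 :=
  fnSmul ((logJac vol F).comp G.toContMDiffMap) (diff (logJac vol G))

theorem groupCocycle_eq (vol : VolumeForm n X) (F G : Diffeo n X) :
    groupCocycle vol F G = cls (cocycleForm vol F G) := by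
  rw [groupCocycle, heisenberg, lnAbs_volQuot_pull_comp]
  rfl

/-- The logarithmic Jacobian is a 1-cocycle. -/
theorem logJac_comp (vol : VolumeForm n X) (F G : Diffeo n X) :
    logJac vol (comp F G) = (logJac vol F).comp G.toContMDiffMap + logJac vol G := by
  rw [← lnAbs_volQuot_pull_comp]
  ext x
  have h0 := top_basis_ne_zero (vol.ne_zero x) (tangentBasis x)
  have h1 := top_basis_ne_zero ((vol.pull G).ne_zero x) (tangentBasis x)
  have h2 := top_basis_ne_zero ((vol.pull (comp F G)).ne_zero x) (tangentBasis x)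
  change Real.log |_ / _| = Real.log |_ / _| + Real.log |_ / _|
  rw [← Real.log_mul (abs_ne_zero.2 (div_ne_zero h2 h1)) (abs_ne_zero.2 (div_ne_zero h1 h0)),
    ← abs_mul, div_mul_div_cancel₀ h1]

theorem isGroupCocycle_groupCocycle (vol : VolumeForm n X) :
    IsGroupCocycle (groupCocycle vol) := by
  intro F G H
  simp only [groupCocycle_eq]
  have h : pullK H (cls (cocycleForm vol F G)) =
      cls (fnSmul (((logJac vol F).comp G.toContMDiffMap).comp H.toContMDiffMap)
        (diff ((logJac vol G).comp H.toContMDiffMap))) := by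
    change cls (pullback H (cocycleForm vol F G)) = _
    rw [cocycleForm, pullback_fnSmul, pullback_diff]
  rw [h, ← map_add, ← map_add]
  congr 1
  rw [cocycleForm, cocycleForm, cocycleForm, logJac_comp, logJac_comp, map_add, map_add]
  have h1 : ((logJac vol F).comp G.toContMDiffMap).comp H.toContMDiffMap =
      (logJac vol F).comp (comp G H).toContMDiffMap := rfl
  have h2 : ((logJac vol F).comp G.toContMDiffMap + logJac vol G).comp H.toContMDiffMap =
      (logJac vol F).comp (comp G H).toContMDiffMap +
        (logJac vol G).comp H.toContMDiffMap := rfl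
  rw [h1, h2, fnSmul_add]
  abel

/-! ### Lie derivatives -/

theorem lieDeriv_apply {k : ℕ} (v : VField n X) (α : Form n X k)
    {w : Fin k → ∀ x : X, TangentSpace (𝓡 n) x} {x : X} (hw : ∀ j, SmoothNear (w j) x) :
    (lieDeriv v α).1 x (fun i => w i x) = lieExpr v α.1 w x :=
  lieAt_apply v α hw

/-- Every family of tangent vectors at a point extends to locally smooth vector fields, so a form
is determined by its values on those. -/
theorem Form.ext_fields {k : ℕ} {α β : Form n X k}
    (h : ∀ (x : X) (w : Fin k → ∀ x : X, TangentSpace (𝓡 n) x), (∀ i, SmoothNear (w i) x) →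
      α.1 x (fun i => w i x) = β.1 x (fun i => w i x)) : α = β := by
  refine Form.ext' fun x ξ => ?_
  have := h x (fun i => extend (EuclideanSpace ℝ (Fin n)) (ξ i)) fun i => smoothNear_extend (ξ i)
  simpa using this

theorem lieDeriv_fnSmul {k : ℕ} (v : VField n X) (f : SmoothFn n X) (α : Form n X k) :
    lieDeriv v (fnSmul f α) = fnSmul (fnDeriv v f) α + fnSmul f (lieDeriv v α) := by
  refine Form.ext_fields fun x w hw => ?_
  change _ = fnDeriv v f x * α.1 x _ + f x * (lieDeriv v α).1 x _
  rw [lieDeriv_apply v _ hw, lieDeriv_apply v _ hw, lieExpr, lieExpr]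
  have h := congr($(mvfderiv_mul (I := 𝓡 n) (f.mdifferentiableAt (x := x)) (form_mdiff α hw))
    (v x))
  have h' : mvfderiv (𝓡 n) (fun y => (fnSmul f α).1 y (fun i => w i y)) x (v x) =
      f x * mvfderiv (𝓡 n) (fun y => α.1 y (fun i => w i y)) x (v x) +
        α.1 x (fun i => w i x) * fnDeriv v f x := h
  rw [h']
  simp only [fnSmul_apply, ← Finset.mul_sum]
  ring

theorem lieDeriv_add_field {k : ℕ} (u v : VField n X) (α : Form n X k) :
    lieDeriv (u + v) α = lieDeriv u α + lieDeriv v α := by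
  refine Form.ext_fields fun x w hw => ?_
  change _ = (lieDeriv u α).1 x _ + (lieDeriv v α).1 x _
  have := isManifold_two n X
  simp only [lieDeriv_apply _ _ hw, lieExpr]
  have h (i : Fin k) : mlieBracket (𝓡 n) (fun y => (u + v) y) (w i) x =
      mlieBracket (𝓡 n) (fun y => u y) (w i) x + mlieBracket (𝓡 n) (fun y => v y) (w i) x :=
    mlieBracket_add_left (u.smoothNear x).mdiff (v.smoothNear x).mdiff
  simp only [h, ContinuousAlternatingMap.map_update_add, Finset.sum_add_distrib]
  rw [ContMDiffSection.coe_add, Pi.add_apply, map_add]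
  ring

theorem lieDeriv_smul_field {k : ℕ} (c : ℝ) (v : VField n X) (α : Form n X k) :
    lieDeriv (c • v) α = c • lieDeriv v α := by
  refine Form.ext_fields fun x w hw => ?_
  change _ = c * (lieDeriv v α).1 x _
  have := isManifold_two n X
  simp only [lieDeriv_apply _ _ hw, lieExpr]
  have h (i : Fin k) : mlieBracket (𝓡 n) (fun y => (c • v) y) (w i) x =
      c • mlieBracket (𝓡 n) (fun y => v y) (w i) x :=
    mlieBracket_const_smul_left (v.smoothNear x).mdiff
  simp only [h, ContinuousAlternatingMap.map_update_smul, smul_eq_mul, ← Finset.mul_sum]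
  rw [ContMDiffSection.coe_smul, Pi.smul_apply, map_smul, smul_eq_mul]
  ring

omit [IsManifold (𝓡 n) ∞ X] in
theorem mvfderiv_apply_congr {V : Type*} [NormedAddCommGroup V] [NormedSpace ℝ V] {f g : X → V}
    {x : X} (h : f =ᶠ[𝓝 x] g) (ξ : TangentSpace (𝓡 n) x) :
    mvfderiv (𝓡 n) f x ξ = mvfderiv (𝓡 n) g x ξ := by
  change mfderiv (𝓡 n) 𝓘(ℝ, V) f x ξ = mfderiv (𝓡 n) 𝓘(ℝ, V) g x ξ
  rw [h.mfderiv_eq]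
  rfl

/-- The bracket acts on a locally smooth function as the commutator of derivations. The function
is replaced by a global one with the same germ, by means of a bump function. -/
theorem mvfderiv_mlieBracket [T2Space X] {f : X → ℝ} {v w : ∀ x : X, TangentSpace (𝓡 n) x} {x : X}
    (hf : FnSmoothNear n f x) (hv : SmoothNear v x) (hw : SmoothNear w x) :
    mvfderiv (𝓡 n) f x (mlieBracket (𝓡 n) v w x) =
      mvfderiv (𝓡 n) (fun y => mvfderiv (𝓡 n) f y (w y)) x (v x) -
        mvfderiv (𝓡 n) (fun y => mvfderiv (𝓡 n) f y (v y)) x (w x) := by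
  obtain ⟨ρ, -, hρ⟩ := (SmoothBumpFunction.nhds_basis_tsupport (I := 𝓡 n) x).mem_iff.1 hf
  have hg : ContMDiff (𝓡 n) 𝓘(ℝ, ℝ) ∞ fun y => ρ y * f y := by
    refine contMDiff_of_tsupport fun y hy => ?_
    have hy' : y ∈ tsupport ρ := tsupport_mul_subset_left hy
    exact ρ.contMDiffAt.mul (hρ hy')
  let g : SmoothFn n X := ⟨fun y => ρ y * f y, hg⟩
  have hgf : (g : X → ℝ) =ᶠ[𝓝 x] f := by
    filter_upwards [ρ.eventuallyEq_one] with y hy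
    change ρ y * f y = f y
    rw [hy, Pi.one_apply, one_mul]
  have hd (y : X) (h : (g : X → ℝ) =ᶠ[𝓝 y] f) (ξ : TangentSpace (𝓡 n) y) :
      mvfderiv (𝓡 n) g y ξ = mvfderiv (𝓡 n) f y ξ := mvfderiv_apply_congr h ξ
  have hd2 (u u' : ∀ x : X, TangentSpace (𝓡 n) x) :
      mvfderiv (𝓡 n) (fun y => mvfderiv (𝓡 n) g y (u y)) x (u' x) =
        mvfderiv (𝓡 n) (fun y => mvfderiv (𝓡 n) f y (u y)) x (u' x) := by
    refine mvfderiv_apply_congr ?_ _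
    filter_upwards [hgf.eventually_nhds] with y hy using hd y hy _
  rw [← hd x hgf, ← hd2, ← hd2]
  exact bracket_apply_fn g hv hw

omit [IsManifold (𝓡 n) ∞ X] in
theorem mvfderiv_finset_sum {ι : Type*} (S : Finset ι) {f : ι → X → ℝ} {x : X}
    (h : ∀ i ∈ S, MDifferentiableAt (𝓡 n) 𝓘(ℝ, ℝ) (f i) x) (ξ : TangentSpace (𝓡 n) x) :
    MDifferentiableAt (𝓡 n) 𝓘(ℝ, ℝ) (fun y => ∑ i ∈ S, f i y) x ∧
    mvfderiv (𝓡 n) (fun y => ∑ i ∈ S, f i y) x ξ = ∑ i ∈ S, mvfderiv (𝓡 n) (f i) x ξ := by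
  classical
  induction S using Finset.induction_on with
  | empty => simp [mvfderiv_const, mdifferentiableAt_const]
  | insert a S ha ih =>
    have ih := ih fun i hi => h i (Finset.mem_insert_of_mem hi)
    have h1 := h a (Finset.mem_insert_self a S)
    simp only [Finset.sum_insert ha]
    refine ⟨h1.add ih.1, ?_⟩
    have h2 := congr($(mvfderiv_add (I := 𝓡 n) h1 ih.1) ξ)
    rw [← ih.2]
    exact h2

/-- The value of `u · (v · α)` on vector fields `w₁, …, w_k`. The second and third terms are
interchanged by swapping `u` and `v`, and the last is symmetric in `u` and `v`, so only the first
and the fourth contribute to the commutator. -/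
theorem lieDeriv_lieDeriv_apply {k : ℕ} (u v : VField n X) (α : Form n X k)
    {w : Fin k → ∀ x : X, TangentSpace (𝓡 n) x} {x : X} (hw : ∀ j, SmoothNear (w j) x) :
    (lieDeriv u (lieDeriv v α)).1 x (fun i => w i x) =
      mvfderiv (𝓡 n) (fun y => mvfderiv (𝓡 n) (fun z => α.1 z (fun i => w i z)) y (v y)) x (u x)
      - ∑ i, mvfderiv (𝓡 n) (fun y => α.1 y (Function.update (fun j => w j y) i
          (mlieBracket (𝓡 n) (fun y => v y) (w i) y))) x (u x)
      - ∑ i, mvfderiv (𝓡 n) (fun y => α.1 y (Function.update (fun j => w j y) i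
          (mlieBracket (𝓡 n) (fun y => u y) (w i) y))) x (v x)
      + ∑ i, α.1 x (Function.update (fun j => w j x) i
          (mlieBracket (𝓡 n) (fun y => v y) (mlieBracket (𝓡 n) (fun y => u y) (w i)) x))
      + ∑ i, ∑ j ∈ Finset.univ.erase i, α.1 x (Function.update (Function.update (fun j => w j x) j
            (mlieBracket (𝓡 n) (fun y => v y) (w j) x)) i
            (mlieBracket (𝓡 n) (fun y => u y) (w i) x)) := by
  have hb (a : VField n X) (i : Fin k) : SmoothNear (mlieBracket (𝓡 n) (fun y => a y) (w i)) x :=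
    (a.smoothNear x).bracket (hw i)
  have hm (i : Fin k) : MDifferentiableAt (𝓡 n) 𝓘(ℝ, ℝ) (fun y => α.1 y
      (Function.update (fun j => w j y) i (mlieBracket (𝓡 n) (fun y => v y) (w i) y))) x := by
    have := form_mdiff α (SmoothNear.update (i := i) hw (hb v i))
    simpa only [update_apply_field] using this
  have h1 : mvfderiv (𝓡 n) (fun y => (lieDeriv v α).1 y (fun i => w i y)) x (u x) =
      mvfderiv (𝓡 n) (fun y => mvfderiv (𝓡 n) (fun z => α.1 z (fun i => w i z)) y (v y)) x (u x)
      - ∑ i, mvfderiv (𝓡 n) (fun y => α.1 y (Function.update (fun j => w j y) i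
          (mlieBracket (𝓡 n) (fun y => v y) (w i) y))) x (u x) := by
    have hev : (fun y => (lieDeriv v α).1 y (fun i => w i y)) =ᶠ[𝓝 x]
        (fun y => mvfderiv (𝓡 n) (fun z => α.1 z (fun i => w i z)) y (v y)) -
        fun y => ∑ i, α.1 y (Function.update (fun j => w j y) i
          (mlieBracket (𝓡 n) (fun y => v y) (w i) y)) := by
      have : ∀ᶠ y in 𝓝 x, ∀ i, SmoothNear (w i) y :=
        Filter.eventually_all.2 fun i => (hw i).eventually_nhds
      filter_upwards [this] with y hy using lieAt_apply v α hy
    have hs := mvfderiv_finset_sum Finset.univ (fun i _ => hm i) (u x)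
    have h0 : MDifferentiableAt (𝓡 n) 𝓘(ℝ, ℝ)
        (fun y => mvfderiv (𝓡 n) (fun z => α.1 z (fun i => w i z)) y (v y)) x :=
      ((v.smoothNear x).dfun (α.2 x w hw)).mdifferentiableAt (by simp)
    rw [← hs.2]
    exact (mvfderiv_apply_congr hev (u x)).trans congr($(mvfderiv_sub (I := 𝓡 n) h0 hs.1) (u x))
  have h2 (i : Fin k) : (lieDeriv v α).1 x (Function.update (fun j => w j x) i
        (mlieBracket (𝓡 n) (fun y => u y) (w i) x)) =
      mvfderiv (𝓡 n) (fun y => α.1 y (Function.update (fun j => w j y) i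
          (mlieBracket (𝓡 n) (fun y => u y) (w i) y))) x (v x) -
      (α.1 x (Function.update (fun j => w j x) i
          (mlieBracket (𝓡 n) (fun y => v y) (mlieBracket (𝓡 n) (fun y => u y) (w i)) x))
        + ∑ j ∈ Finset.univ.erase i, α.1 x (Function.update (Function.update (fun j => w j x) j
            (mlieBracket (𝓡 n) (fun y => v y) (w j) x)) i
            (mlieBracket (𝓡 n) (fun y => u y) (w i) x))) := by
    rw [← lieExpr_update, ← lieDeriv_apply v α (SmoothNear.update (i := i) hw (hb u i)),
      update_apply_field]
  rw [lieDeriv_apply u _ hw, lieExpr, h1]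
  simp only [h2, Finset.sum_sub_distrib, Finset.sum_add_distrib]
  ring

/-- The Lie derivative is a representation of the Lie algebra of vector fields on forms. -/
theorem lieDeriv_bracket [T2Space X] {k : ℕ} (u v : VField n X) (α : Form n X k) :
    lieDeriv (bracket u v) α = lieDeriv u (lieDeriv v α) - lieDeriv v (lieDeriv u α) := by
  refine Form.ext_fields fun x w hw => ?_
  change _ = (lieDeriv u (lieDeriv v α)).1 x _ - (lieDeriv v (lieDeriv u α)).1 x _
  rw [lieDeriv_lieDeriv_apply u v α hw, lieDeriv_lieDeriv_apply v u α hw, lieDeriv_apply _ _ hw,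
    lieExpr]
  have hf : FnSmoothNear n (fun z => α.1 z (fun i => w i z)) x := by
    have : ∀ᶠ y in 𝓝 x, ∀ i, SmoothNear (w i) y :=
      Filter.eventually_all.2 fun i => (hw i).eventually_nhds
    filter_upwards [this] with y hy using α.2 y w hy
  have h1 : mvfderiv (𝓡 n) (fun z => α.1 z (fun i => w i z)) x (bracket u v x) = _ :=
    mvfderiv_mlieBracket hf (u.smoothNear x) (v.smoothNear x)
  -- The terms containing both a bracket with `u` and one with `v` are symmetric.
  have hswap : ∑ i, ∑ j ∈ Finset.univ.erase i, α.1 x (Function.update (Function.update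
        (fun j => w j x) j (mlieBracket (𝓡 n) (fun y => v y) (w j) x)) i
          (mlieBracket (𝓡 n) (fun y => u y) (w i) x)) =
      ∑ i, ∑ j ∈ Finset.univ.erase i, α.1 x (Function.update (Function.update
        (fun j => w j x) j (mlieBracket (𝓡 n) (fun y => u y) (w j) x)) i
          (mlieBracket (𝓡 n) (fun y => v y) (w i) x)) := by
    rw [Finset.sum_comm' (t' := Finset.univ) (s' := fun j => Finset.univ.erase j)
      (by simp [ne_comm])]
    refine Finset.sum_congr rfl fun i _ => Finset.sum_congr rfl fun j hj => ?_
    rw [Function.update_comm (Finset.ne_of_mem_erase hj).symm]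
  -- The Jacobi identity.
  have h2 (i : Fin k) : α.1 x (Function.update (fun j => w j x) i
        (mlieBracket (𝓡 n) (fun y => bracket u v y) (w i) x)) =
      α.1 x (Function.update (fun j => w j x) i
        (mlieBracket (𝓡 n) (fun y => u y) (mlieBracket (𝓡 n) (fun y => v y) (w i)) x)) -
      α.1 x (Function.update (fun j => w j x) i
        (mlieBracket (𝓡 n) (fun y => v y) (mlieBracket (𝓡 n) (fun y => u y) (w i)) x)) := by
    have h3 : IsManifold (𝓡 n) (minSmoothness ℝ 3) X := by
      rw [minSmoothness_of_isRCLikeNormedField]; infer_instance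
    have hc {a : ∀ x : X, TangentSpace (𝓡 n) x} (ha : SmoothNear a x) :
        ContMDiffAt (𝓡 n) (𝓡 n).tangent (minSmoothness ℝ 2)
          (fun y => (⟨y, a y⟩ : TangentBundle (𝓡 n) X)) x :=
      ha.contMDiffAt.of_le (by
        rw [minSmoothness_of_isRCLikeNormedField]
        exact WithTop.coe_le_coe.2 (le_top (a := (2 : ℕ∞))))
    have h4 := leibniz_identity_mlieBracket_apply (I := 𝓡 n) (hc (u.smoothNear x))
      (hc (v.smoothNear x)) (hc (hw i))
    have h5 : mlieBracket (𝓡 n) (fun y => bracket u v y) (w i) x =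
        mlieBracket (𝓡 n) (mlieBracket (𝓡 n) (fun y => u y) (fun y => v y)) (w i) x := rfl
    rw [h5, eq_sub_iff_add_eq, h4]
    exact ((α.1 x).map_update_add _ i _ _).symm
  rw [h1, hswap]
  simp only [h2, Finset.sum_sub_distrib]
  ring

/-! ### The divergence and the Lie algebra cocycle -/

theorem lieDeriv_volume (vol : VolumeForm n X) (v : VField n X) :
    lieDeriv v vol.form = fnSmul (divergence vol v) vol.form :=
  topQuot_spec _ vol

theorem divergence_add (vol : VolumeForm n X) (u v : VField n X) :
    divergence vol (u + v) = divergence vol u + divergence vol v :=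
  topQuot_eq (by rw [lieDeriv_add_field, lieDeriv_volume, lieDeriv_volume, fnSmul_add])

theorem divergence_smul (vol : VolumeForm n X) (c : ℝ) (v : VField n X) :
    divergence vol (c • v) = c • divergence vol v :=
  topQuot_eq (by rw [lieDeriv_smul_field, lieDeriv_volume, fnSmul_const_smul])

/-- The divergence is a 1-cocycle on vector fields with values in functions. -/
theorem divergence_bracket [T2Space X] (vol : VolumeForm n X) (u v : VField n X) :
    divergence vol (bracket u v) =
      fnDeriv u (divergence vol v) - fnDeriv v (divergence vol u) := by
  refine topQuot_eq ?_
  rw [lieDeriv_bracket, lieDeriv_volume, lieDeriv_volume, lieDeriv_fnSmul, lieDeriv_fnSmul,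
    lieDeriv_volume, lieDeriv_volume]
  refine Form.ext' fun x ξ => ?_
  have key : ∀ p q a b o : ℝ, p * o + b * (a * o) - (q * o + a * (b * o)) = (p - q) * o :=
    fun _ _ _ _ _ => by ring
  exact key (fnDeriv u (divergence vol v) x) (fnDeriv v (divergence vol u) x)
    (divergence vol u x) (divergence vol v x) (vol.form.1 x ξ)

theorem lieK_cls_fnSmul_diff (v : VField n X) (f g : SmoothFn n X) :
    lieK v (cls (fnSmul f (diff g))) =
      cls (fnSmul (fnDeriv v f) (diff g)) + cls (fnSmul f (diff (fnDeriv v g))) := by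
  change cls (lieDeriv v (fnSmul f (diff g))) = _
  rw [lieDeriv_fnSmul, lieDeriv_diff, map_add]

theorem isLieCocycle_lieCocycle [T2Space X] (vol : VolumeForm n X) :
    IsLieCocycle (lieCocycle vol) where
  add_left v v' w := by simp only [lieCocycle, divergence_add, fnSmul_add, map_add]
  smul_left a v w := by simp only [lieCocycle, divergence_smul, fnSmul_const_smul, map_smul]
  add_right v w w' := by simp only [lieCocycle, divergence_add, map_add]
  smul_right a v w := by simp only [lieCocycle, divergence_smul, map_smul]
  alternating v := cls_fnSmul_diff_self _
  differential u v w := by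
    have hsub (f g : SmoothFn n X) (α : Form n X 1) :
        cls (fnSmul (f - g) α) = cls (fnSmul f α) - cls (fnSmul g α) := by
      rw [← map_sub]
      exact congrArg cls (Form.ext' fun x ξ => sub_mul (f x) (g x) (α.1 x ξ))
    simp only [lieCocycle, lieK_cls_fnSmul_diff, divergence_bracket, hsub]
    -- The terms that do not cancel pair up to `d (b · u c) - d (a · v c) + d (a · w b)`, where
    -- `a`, `b`, `c` are the divergences of `u`, `v`, `w`.
    rw [cls_fnSmul_diff_swap (divergence vol v) (fnDeriv u (divergence vol w)),
      cls_fnSmul_diff_swap (divergence vol u) (fnDeriv v (divergence vol w)),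
      cls_fnSmul_diff_swap (divergence vol u) (fnDeriv w (divergence vol v))]
    abel

/-! ### Top-degree forms in local frames -/

/-- The local frame of the tangent bundle around `x` given by the coordinate fields of the chart at
`x`. -/
def coordFrame (x : X) (i : Fin n) : ∀ y : X, TangentSpace (𝓡 n) y :=
  (trivializationAt (EuclideanSpace ℝ (Fin n)) (TangentSpace (𝓡 n) : X → Type _) x).localFrame
    (EuclideanSpace.basisFun (Fin n) ℝ).toBasis i

/-- The isomorphism of the tangent space at a point `y` near `x` with `ℝⁿ` given by the chart
at `x`. -/
def chartDeriv (x y : X) : TangentSpace (𝓡 n) y →L[ℝ] EuclideanSpace ℝ (Fin n) :=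
  (trivializationAt (EuclideanSpace ℝ (Fin n)) (TangentSpace (𝓡 n) : X → Type _)
    x).continuousLinearMapAt ℝ y

theorem mem_baseSet_iff {x y : X} :
    y ∈ (trivializationAt (EuclideanSpace ℝ (Fin n)) (TangentSpace (𝓡 n) : X → Type _) x).baseSet ↔
      y ∈ (chartAt (EuclideanSpace ℝ (Fin n)) x).source := by
  rw [TangentBundle.trivializationAt_baseSet]

omit [IsManifold (𝓡 n) ∞ X] in
theorem chart_source_mem_nhds (x : X) :
    (chartAt (EuclideanSpace ℝ (Fin n)) x).source ∈ 𝓝 x :=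
  (chartAt (EuclideanSpace ℝ (Fin n)) x).open_source.mem_nhds (mem_chart_source _ x)

theorem coordFrame_smoothNear (x : X) (i : Fin n) {y : X}
    (hy : y ∈ (chartAt (EuclideanSpace ℝ (Fin n)) x).source) : SmoothNear (coordFrame x i) y := by
  filter_upwards [(chartAt (EuclideanSpace ℝ (Fin n)) x).open_source.mem_nhds hy] with z hz
  exact contMDiffAt_localFrame_of_mem (I := 𝓡 n) ∞ _ _ i (mem_baseSet_iff.2 hz)

theorem coordFrame_eq_symmL {x y : X} (i : Fin n)
    (hy : y ∈ (chartAt (EuclideanSpace ℝ (Fin n)) x).source) :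
    coordFrame x i y = (trivializationAt (EuclideanSpace ℝ (Fin n))
      (TangentSpace (𝓡 n) : X → Type _) x).symmL ℝ y (EuclideanSpace.basisFun (Fin n) ℝ i) := by
  rw [coordFrame, Bundle.Trivialization.localFrame_apply_of_mem_baseSet _ _ (mem_baseSet_iff.2 hy)]
  rw [Bundle.Trivialization.basisAt, Module.Basis.map_apply, OrthonormalBasis.coe_toBasis,
    Bundle.Trivialization.symmL_apply _ (mem_baseSet_iff.2 hy)]
  rfl

theorem chartDeriv_coordFrame {x y : X} (i : Fin n)
    (hy : y ∈ (chartAt (EuclideanSpace ℝ (Fin n)) x).source) :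
    chartDeriv x y (coordFrame x i y) = EuclideanSpace.basisFun (Fin n) ℝ i := by
  rw [coordFrame_eq_symmL i hy]
  exact Bundle.Trivialization.continuousLinearMapAt_symmL _ (mem_baseSet_iff.2 hy) _

theorem chartDeriv_eq_mvfderiv {x y : X}
    (hy : y ∈ (chartAt (EuclideanSpace ℝ (Fin n)) x).source) (ξ : TangentSpace (𝓡 n) y) :
    chartDeriv x y ξ = mvfderiv (𝓡 n) (extChartAt (𝓡 n) x) y ξ :=
  congr($(TangentBundle.continuousLinearMapAt_trivializationAt (I := 𝓡 n) hy) ξ)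

variable (n) in
/-- The determinant of `n` vectors in `ℝⁿ`. -/
def detMap : ContinuousMultilinearMap ℝ (fun _ : Fin n => EuclideanSpace ℝ (Fin n)) ℝ :=
  ⟨(EuclideanSpace.basisFun (Fin n) ℝ).toBasis.det.toMultilinearMap, continuous_multilinear _⟩

theorem detMap_basis : detMap n (fun i => EuclideanSpace.basisFun (Fin n) ℝ i) = 1 := by
  change (EuclideanSpace.basisFun (Fin n) ℝ).toBasis.det (fun i => _) = 1
  rw [← (EuclideanSpace.basisFun (Fin n) ℝ).toBasis.det_self]
  congr 1

/-- In the coordinate frame a top-degree form is a multiple of the determinant. -/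
theorem top_apply_eq_detMap {x y : X} (hy : y ∈ (chartAt (EuclideanSpace ℝ (Fin n)) x).source)
    (η : TangentSpace (𝓡 n) y [⋀^Fin n]→L[ℝ] ℝ) (ξ : Fin n → TangentSpace (𝓡 n) y) :
    η ξ = η (fun i => coordFrame x i y) * detMap n (fun i => chartDeriv x y (ξ i)) := by
  let t := trivializationAt (EuclideanSpace ℝ (Fin n)) (TangentSpace (𝓡 n) : X → Type _) x
  let b := (EuclideanSpace.basisFun (Fin n) ℝ).toBasis
  have hy' : y ∈ t.baseSet := mem_baseSet_iff.2 hy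
  have h1 : η ξ = η (t.basisAt b hy') * (t.basisAt b hy').det ξ :=
    congr($(η.toAlternatingMap.eq_smul_basis_det (t.basisAt b hy')) ξ)
  have h2 : (fun i => coordFrame x i y) = t.basisAt b hy' := by
    funext i
    exact t.localFrame_apply_of_mem_baseSet b hy'
  rw [h1, h2, Bundle.Trivialization.basisAt, Module.Basis.det_map]
  refine congrArg (fun a => η (b.map _) * b.det a) (funext fun i => ?_)
  simp [chartDeriv, t, Bundle.Trivialization.continuousLinearMapAt_apply,
    Bundle.Trivialization.linearMapAt_def_of_mem _ hy']

theorem volume_coordFrame_ne_zero (vol : VolumeForm n X) {x y : X}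
    (hy : y ∈ (chartAt (EuclideanSpace ℝ (Fin n)) x).source) :
    vol.form.1 y (fun i => coordFrame x i y) ≠ 0 := by
  intro h
  refine top_basis_ne_zero (vol.ne_zero y) (tangentBasis y) ?_
  rw [top_apply_eq_detMap hy, h, zero_mul]

theorem topQuot_apply_coordFrame (η : Form n X n) (vol : VolumeForm n X) {x y : X}
    (hy : y ∈ (chartAt (EuclideanSpace ℝ (Fin n)) x).source) :
    topQuot η vol y =
      η.1 y (fun i => coordFrame x i y) / vol.form.1 y (fun i => coordFrame x i y) := by
  rw [eq_div_iff (volume_coordFrame_ne_zero vol hy)]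
  exact congr(($((topQuot_spec η vol).symm)).1 y (fun i => coordFrame x i y))

/-- The Jacobian `ω(F) / ω`, computed in charts around `y` and around `F y`. -/
theorem jacobian_eq (vol : VolumeForm n X) (F : Diffeo n X) {x x' y : X}
    (hy : y ∈ (chartAt (EuclideanSpace ℝ (Fin n)) x).source)
    (hFy : F y ∈ (chartAt (EuclideanSpace ℝ (Fin n)) x').source) :
    (volQuot (vol.pull F) vol).fn y =
      vol.form.1 (F y) (fun i => coordFrame x' i (F y)) *
        detMap n (fun i => chartDeriv x' (F y) (mfderiv (𝓡 n) (𝓡 n) F y (coordFrame x i y))) /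
      vol.form.1 y (fun i => coordFrame x i y) := by
  refine (topQuot_apply_coordFrame _ vol hy).trans ?_
  rw [← top_apply_eq_detMap hFy]
  rfl

/-! ### Smooth families of diffeomorphisms -/

/-- The Jacobians of a smooth family of diffeomorphisms depend smoothly on the parameter and the
point: in charts they are given by the coefficient of the volume form and the determinant of the
differentials. -/
theorem contMDiff_jacobian (vol : VolumeForm n X) {F : ℝ → Diffeo n X}
    (hF : ContMDiff (𝓘(ℝ, ℝ).prod (𝓡 n)) (𝓡 n) ∞ (fun p : ℝ × X => F p.1 p.2)) :
    ContMDiff (𝓘(ℝ, ℝ).prod (𝓡 n)) 𝓘(ℝ, ℝ) ∞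
      (fun p : ℝ × X => (volQuot (vol.pull (F p.1)) vol).fn p.2) := by
  rintro ⟨s, x⟩
  have : IsManifold (𝓡 n) 1 X := .of_le (n := ∞) (by simp)
  have hg (x : X) : ContMDiffAt (𝓡 n) 𝓘(ℝ, ℝ) ∞
      (fun y => vol.form.1 y (fun i => coordFrame x i y)) x :=
    vol.form.2 x _ fun i => coordFrame_smoothNear x i (mem_chart_source _ x)
  have hA := ContMDiffAt.mfderiv (m := ∞) (n := ∞) (J := 𝓘(ℝ, ℝ).prod (𝓡 n)) (I := 𝓡 n)
    (I' := 𝓡 n) (x₀ := (s, x)) (fun p : ℝ × X => (F p.1 : X → X)) Prod.snd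
    ((hF.comp ((contMDiff_fst.comp contMDiff_fst).prodMk contMDiff_snd)).contMDiffAt)
    contMDiffAt_snd (by simp)
  have hD : ContMDiffAt (𝓘(ℝ, ℝ).prod (𝓡 n)) 𝓘(ℝ, ℝ) ∞ (fun p : ℝ × X => detMap n fun i =>
      inTangentCoordinates (𝓡 n) (𝓡 n) Prod.snd (fun p : ℝ × X => F p.1 p.2)
        (fun p : ℝ × X => mfderiv (𝓡 n) (𝓡 n) (F p.1) p.2) (s, x) p
        (EuclideanSpace.basisFun (Fin n) ℝ i)) (s, x) := by
    refine ((detMap n).contDiff (n := ∞)).contMDiff.contMDiffAt.comp (s, x) ?_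
    rw [contMDiffAt_pi_space]
    intro i
    exact hA.clm_apply contMDiffAt_const
  have h1 : ContMDiffAt (𝓘(ℝ, ℝ).prod (𝓡 n)) 𝓘(ℝ, ℝ) ∞ (fun p : ℝ × X =>
      vol.form.1 (F p.1 p.2) (fun i => coordFrame (F s x) i (F p.1 p.2))) (s, x) :=
    (hg (F s x)).comp (s, x) hF.contMDiffAt
  have h2 : ContMDiffAt (𝓘(ℝ, ℝ).prod (𝓡 n)) 𝓘(ℝ, ℝ) ∞ (fun p : ℝ × X =>
      vol.form.1 p.2 (fun i => coordFrame x i p.2)) (s, x) :=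
    (hg x).comp (s, x) contMDiffAt_snd
  refine ((h1.mul hD).div₀ h2
    (volume_coordFrame_ne_zero vol (mem_chart_source _ x))).congr_of_eventuallyEq ?_
  have e1 : ∀ᶠ p : ℝ × X in 𝓝 (s, x), p.2 ∈ (chartAt (EuclideanSpace ℝ (Fin n)) x).source :=
    continuous_snd.continuousAt.eventually (chart_source_mem_nhds x)
  have e2 : ∀ᶠ p : ℝ × X in 𝓝 (s, x),
      F p.1 p.2 ∈ (chartAt (EuclideanSpace ℝ (Fin n)) (F s x)).source :=
    hF.continuous.continuousAt.eventually (chart_source_mem_nhds (F s x))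
  filter_upwards [e1, e2] with p hp hFp
  have h3 (i : Fin n) : chartDeriv (F s x) (F p.1 p.2)
      (mfderiv (𝓡 n) (𝓡 n) (F p.1) p.2 (coordFrame x i p.2)) =
      inTangentCoordinates (𝓡 n) (𝓡 n) Prod.snd (fun p : ℝ × X => F p.1 p.2)
        (fun p : ℝ × X => mfderiv (𝓡 n) (𝓡 n) (F p.1) p.2) (s, x) p
        (EuclideanSpace.basisFun (Fin n) ℝ i) := by
    rw [coordFrame_eq_symmL i hp]
    rfl
  rw [jacobian_eq vol (F p.1) hp hFp]
  simp only [h3]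
  rfl

theorem contMDiff_logJac (vol : VolumeForm n X) {F : ℝ → Diffeo n X}
    (hF : ContMDiff (𝓘(ℝ, ℝ).prod (𝓡 n)) (𝓡 n) ∞ (fun p : ℝ × X => F p.1 p.2)) :
    ContMDiff (𝓘(ℝ, ℝ).prod (𝓡 n)) 𝓘(ℝ, ℝ) ∞ (fun p : ℝ × X => logJac vol (F p.1) p.2) := by
  intro p
  change ContMDiffAt _ _ _
    (fun p : ℝ × X => Real.log |(volQuot (vol.pull (F p.1)) vol).fn p.2|) p
  simp only [Real.log_abs]
  exact (Real.contDiffAt_log.2 ((volQuot (vol.pull (F p.1)) vol).ne_zero p.2)).contMDiffAt.comp p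
    (contMDiff_jacobian vol hF p)

/-- The derivatives along `X` of a smooth family of functions depend smoothly on the parameter and
the point. -/
theorem contMDiffAt_mvfderiv_family {h : ℝ → X → ℝ} {w : ∀ x : X, TangentSpace (𝓡 n) x} {x : X}
    {s : ℝ} (hh : ContMDiff (𝓘(ℝ, ℝ).prod (𝓡 n)) 𝓘(ℝ, ℝ) ∞ (fun p : ℝ × X => h p.1 p.2))
    (hw : SmoothNear w x) :
    ContMDiffAt (𝓘(ℝ, ℝ).prod (𝓡 n)) 𝓘(ℝ, ℝ) ∞
      (fun p : ℝ × X => mvfderiv (𝓡 n) (h p.1) p.2 (w p.2)) (s, x) := by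
  have : IsManifold (𝓡 n) 1 X := .of_le (n := ∞) (by simp)
  have h1 := ContMDiffAt.mfderiv (m := ∞) (n := ∞) (J := 𝓘(ℝ, ℝ).prod (𝓡 n)) (I := 𝓡 n)
    (I' := 𝓘(ℝ, ℝ)) (x₀ := (s, x)) (fun p : ℝ × X => h p.1) Prod.snd
    ((hh.comp ((contMDiff_fst.comp contMDiff_fst).prodMk contMDiff_snd)).contMDiffAt)
    contMDiffAt_snd (by simp)
  have hw' : ContMDiffAt (𝓘(ℝ, ℝ).prod (𝓡 n)) (𝓡 n).tangent ∞
      (fun p : ℝ × X => (⟨p.2, w p.2⟩ : TangentBundle (𝓡 n) X)) (s, x) :=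
    hw.contMDiffAt.comp (s, x) contMDiffAt_snd
  have h2 := ContMDiffAt.clm_apply_of_inCoordinates (b₁ := Prod.snd)
    (b₂ := fun p : ℝ × X => h p.1 p.2) (v := fun p : ℝ × X => w p.2)
    (ϕ := fun p : ℝ × X => mfderiv (𝓡 n) 𝓘(ℝ, ℝ) (h p.1) p.2) h1 hw' hh.contMDiffAt
  rw [Bundle.contMDiffAt_totalSpace] at h2
  simpa using! h2.2

/-! ### Differentiating in the parameter -/

theorem eventually_differentiableAt {E V : Type*} [NormedAddCommGroup E] [NormedSpace ℝ E]
    [NormedAddCommGroup V] [NormedSpace ℝ V] {H : E → V} {p : E} (hH : ContDiffAt ℝ 2 H p) :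
    ∀ᶠ q in 𝓝 p, DifferentiableAt ℝ H q := by
  filter_upwards [hH.eventually (by simp)] with q hq using hq.differentiableAt (by simp)

theorem hasFDerivAt_deriv_family {E V : Type*} [NormedAddCommGroup E] [NormedSpace ℝ E]
    [NormedAddCommGroup V] [NormedSpace ℝ V] {H : ℝ × E → V} {s : ℝ} {z : E}
    (hH : ContDiffAt ℝ 2 H (s, z)) :
    HasFDerivAt (fun y => deriv (fun r => H (r, y)) s)
      (((ContinuousLinearMap.apply ℝ V ((1, 0) : ℝ × E)).comp
        (fderiv ℝ (fderiv ℝ H) (s, z))).comp (ContinuousLinearMap.inr ℝ ℝ E)) z := by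
  have h2 : DifferentiableAt ℝ (fderiv ℝ H) (s, z) :=
    (hH.fderiv_right (m := 1) (by norm_num [one_add_one_eq_two])).differentiableAt (by simp)
  have hs : (fun y => deriv (fun r => H (r, y)) s) =ᶠ[𝓝 z]
      fun y => fderiv ℝ H (s, y) (1, 0) := by
    have hc : ContinuousAt (fun y : E => (s, y)) z := by fun_prop
    filter_upwards [hc.eventually (eventually_differentiableAt hH)] with y hy
    have h := hy.hasFDerivAt.comp_hasDerivAt s
      ((hasDerivAt_id s).prodMk (hasDerivAt_const s y))
    exact h.deriv
  have h := h2.hasFDerivAt.comp z (hasFDerivAt_prodMk_right (𝕜 := ℝ) s z)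
  exact ((ContinuousLinearMap.apply ℝ V ((1, 0) : ℝ × E)).hasFDerivAt.comp z
    h).congr_of_eventuallyEq hs

/-- The derivative in a parameter commutes with the derivative in space. -/
theorem hasDerivAt_fderiv_family {E V : Type*} [NormedAddCommGroup E] [NormedSpace ℝ E]
    [NormedAddCommGroup V] [NormedSpace ℝ V] {H : ℝ × E → V} {s : ℝ} {z : E}
    (hH : ContDiffAt ℝ 2 H (s, z)) (e : E) :
    HasDerivAt (fun r => fderiv ℝ (fun y => H (r, y)) z e)
      (fderiv ℝ (fun y => deriv (fun r => H (r, y)) s) z e) s := by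
  have h2 : DifferentiableAt ℝ (fderiv ℝ H) (s, z) :=
    (hH.fderiv_right (m := 1) (by norm_num [one_add_one_eq_two])).differentiableAt (by simp)
  have hz : (fun r => fderiv ℝ (fun y => H (r, y)) z e) =ᶠ[𝓝 s]
      fun r => fderiv ℝ H (r, z) (0, e) := by
    have hc : ContinuousAt (fun r : ℝ => (r, z)) s := by fun_prop
    filter_upwards [hc.eventually (eventually_differentiableAt hH)] with r hr
    have h := hr.hasFDerivAt.comp z (hasFDerivAt_prodMk_right (𝕜 := ℝ) r z)
    have h' : HasFDerivAt (fun y => H (r, y)) _ z := h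
    rw [h'.fderiv]
    simp
  have h3 : HasDerivAt (fun r => fderiv ℝ H (r, z) (0, e))
      (fderiv ℝ (fderiv ℝ H) (s, z) (1, 0) (0, e)) s := by
    have h := h2.hasFDerivAt.comp_hasDerivAt s ((hasDerivAt_id s).prodMk (hasDerivAt_const s z))
    exact h.clm_apply (hasDerivAt_const s ((0, e) : ℝ × E)) |>.congr_deriv (by simp)
  rw [(hasFDerivAt_deriv_family hH).fderiv]
  refine (h3.congr_of_eventuallyEq hz).congr_deriv ?_
  exact (hH.isSymmSndFDerivAt (by simp)).eq (1, 0) (0, e)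

/-- On a manifold, too, the derivative in a parameter commutes with the differential. -/
theorem hasDerivAt_mvfderiv_family {V : Type*} [NormedAddCommGroup V] [NormedSpace ℝ V]
    {h : ℝ → X → V} {s : ℝ} {x : X}
    (hh : ContMDiffAt (𝓘(ℝ, ℝ).prod (𝓡 n)) 𝓘(ℝ, V) ∞ (fun p : ℝ × X => h p.1 p.2) (s, x))
    (ξ : TangentSpace (𝓡 n) x) :
    HasDerivAt (fun r => mvfderiv (𝓡 n) (h r) x ξ)
      (mvfderiv (𝓡 n) (fun y => deriv (fun r => h r y) s) x ξ) s := by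
  let φ := extChartAt (𝓡 n) x
  let H : ℝ × EuclideanSpace ℝ (Fin n) → V := fun p => h p.1 (φ.symm p.2)
  have hφ : MDifferentiableAt (𝓡 n) 𝓘(ℝ, EuclideanSpace ℝ (Fin n)) φ x :=
    mdifferentiableAt_extChartAt (by simp)
  have hx : φ.symm (φ x) = x := φ.left_inv (mem_extChartAt_source x)
  have hH : ContDiffAt ℝ ∞ H (s, φ x) := by
    have h1 : ContMDiffAt 𝓘(ℝ, EuclideanSpace ℝ (Fin n)) (𝓡 n) ∞ φ.symm (φ x) :=
      (contMDiffOn_extChartAt_symm x).contMDiffAt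
        ((isOpen_extChartAt_target x).mem_nhds (φ.map_source (mem_extChartAt_source x)))
    have h2 : ContMDiffAt (𝓘(ℝ, ℝ).prod 𝓘(ℝ, EuclideanSpace ℝ (Fin n)))
        (𝓘(ℝ, ℝ).prod (𝓡 n)) ∞
        (fun p : ℝ × EuclideanSpace ℝ (Fin n) => (p.1, φ.symm p.2)) (s, φ x) :=
      contMDiffAt_fst.prodMk (h1.comp (s, φ x) contMDiffAt_snd)
    have h3 : ContMDiffAt (𝓘(ℝ, ℝ).prod 𝓘(ℝ, EuclideanSpace ℝ (Fin n))) 𝓘(ℝ, V) ∞ H (s, φ x) :=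
      ContMDiffAt.comp (s, φ x) (by rw [hx]; exact hh) h2
    rw [← modelWithCornersSelf_prod, chartedSpaceSelf_prod] at h3
    exact h3.contDiffAt
  -- The differential at `x` of a function that factors through the chart.
  have key {f : X → V} {g : EuclideanSpace ℝ (Fin n) → V} (hfg : ∀ᶠ y in 𝓝 x, f y = g (φ y))
      (hg : DifferentiableAt ℝ g (φ x)) :
      mvfderiv (𝓡 n) f x ξ =
        fderiv ℝ g (φ x) (mfderiv (𝓡 n) 𝓘(ℝ, EuclideanSpace ℝ (Fin n)) φ x ξ) := by
    have hfg' : f =ᶠ[𝓝 x] g ∘ φ := hfg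
    rw [mvfderiv_apply_congr hfg']
    change mfderiv (𝓡 n) 𝓘(ℝ, V) (g ∘ φ) x ξ = _
    rw [mfderiv_comp x hg.mdifferentiableAt hφ, mfderiv_eq_fderiv]
    rfl
  have hsrc : ∀ᶠ y in 𝓝 x, φ.symm (φ y) = y := by
    filter_upwards [extChartAt_source_mem_nhds (I := 𝓡 n) x] with y hy using φ.left_inv hy
  have hH2 : ContDiffAt ℝ 2 H (s, φ x) :=
    hH.of_le (WithTop.coe_le_coe.2 (le_top (a := (2 : ℕ∞))))
  have h1 := hasDerivAt_fderiv_family hH2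
    (mfderiv (𝓡 n) 𝓘(ℝ, EuclideanSpace ℝ (Fin n)) φ x ξ)
  have hev : (fun r => mvfderiv (𝓡 n) (h r) x ξ) =ᶠ[𝓝 s] fun r =>
      fderiv ℝ (fun y => H (r, y)) (φ x)
        (mfderiv (𝓡 n) 𝓘(ℝ, EuclideanSpace ℝ (Fin n)) φ x ξ) := by
    have hc : ContinuousAt (fun r : ℝ => (r, φ x)) s := by fun_prop
    filter_upwards [hc.eventually (eventually_differentiableAt hH2)] with r hr
    refine key (hsrc.mono fun y hy => by simp [H, hy]) ?_
    exact hr.comp (φ x) (hasFDerivAt_prodMk_right (𝕜 := ℝ) r (φ x)).differentiableAt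
  refine (h1.congr_of_eventuallyEq hev).congr_deriv (key (hsrc.mono fun y hy => by simp [H, hy])
    (hasFDerivAt_deriv_family hH2).differentiableAt).symm

theorem IsCurve.apply_zero {F : ℝ → Diffeo n X} {v : VField n X} (hF : IsCurve F v) (x : X) :
    F 0 x = x := by
  rw [hF.zero]
  rfl

theorem IsCurve.hasDerivAt_comp {F : ℝ → Diffeo n X} {v : VField n X} (hF : IsCurve F v)
    {V : Type*} [NormedAddCommGroup V] [NormedSpace ℝ V] {f : X → V} {x : X}
    (hf : MDifferentiableAt (𝓡 n) 𝓘(ℝ, V) f x) :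
    HasDerivAt (fun s => f (F s x)) (mvfderiv (𝓡 n) f x (v x)) 0 := by
  have hf' : MDifferentiableAt (𝓡 n) 𝓘(ℝ, V) f (F 0 x) := by rwa [hF.apply_zero]
  have h1 : HasFDerivAt (fun s => f (F s x)) ((mvfderiv (𝓡 n) f (F 0 x)).comp
      ((1 : ℝ →L[ℝ] ℝ).smulRight (v (F 0 x))) : ℝ →L[ℝ] V) 0 :=
    (hf'.hasMFDerivAt.comp (0 : ℝ) (hF.velocity x)).hasFDerivAt
  have h2 : mvfderiv (𝓡 n) f (F 0 x) (v (F 0 x)) = mvfderiv (𝓡 n) f x (v x) := by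
    rw [hF.apply_zero]
  rw [← h2]
  refine h1.hasDerivAt.congr_deriv ?_
  simp

/-- In the chart at `x`, the coordinate frame is constant, so the bracket of `v` with a frame field
is minus the derivative of the coordinates of `v` along it. -/
theorem chartDeriv_mlieBracket_coordFrame [T2Space X] (v : VField n X) (x : X) (i : Fin n) :
    chartDeriv x x (mlieBracket (𝓡 n) (fun y => v y) (coordFrame x i) x) =
      -mvfderiv (𝓡 n) (fun y => mvfderiv (𝓡 n) (extChartAt (𝓡 n) x) y (v y)) x
        (coordFrame x i x) := by
  have hx := mem_chart_source (EuclideanSpace ℝ (Fin n)) x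
  have hsrc := chart_source_mem_nhds (n := n) x
  rw [chartDeriv_eq_mvfderiv hx]
  ext j
  let L : EuclideanSpace ℝ (Fin n) →L[ℝ] ℝ := EuclideanSpace.proj j
  have hL {f : X → EuclideanSpace ℝ (Fin n)} {y : X}
      (hf : MDifferentiableAt (𝓡 n) 𝓘(ℝ, EuclideanSpace ℝ (Fin n)) f y)
      (ξ : TangentSpace (𝓡 n) y) :
      mvfderiv (𝓡 n) (fun z => f z j) y ξ = mvfderiv (𝓡 n) f y ξ j := by
    have h := mfderiv_comp y (L.hasMFDerivAt (x := f y)).mdifferentiableAt hf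
    rw [(L.hasMFDerivAt (x := f y)).mfderiv] at h
    exact congr($h ξ)
  have hφ {y : X} (hy : y ∈ (chartAt (EuclideanSpace ℝ (Fin n)) x).source) :
      ContMDiffAt (𝓡 n) 𝓘(ℝ, EuclideanSpace ℝ (Fin n)) ∞ (extChartAt (𝓡 n) x) y :=
    contMDiffAt_extChartAt' hy
  have hφj : FnSmoothNear n (fun z => extChartAt (𝓡 n) x z j) x := by
    filter_upwards [hsrc] with y hy
    exact L.contDiff.contMDiff.contMDiffAt.comp y (hφ hy)
  have hsn := coordFrame_smoothNear x i hx
  have h := mvfderiv_mlieBracket hφj (v.smoothNear x) hsn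
  have hconst : (fun y => mvfderiv (𝓡 n) (fun z => extChartAt (𝓡 n) x z j) y (coordFrame x i y))
      =ᶠ[𝓝 x] fun _ => EuclideanSpace.basisFun (Fin n) ℝ i j := by
    filter_upwards [hsrc] with y hy
    rw [hL ((hφ hy).mdifferentiableAt (by simp)), ← chartDeriv_eq_mvfderiv hy,
      chartDeriv_coordFrame i hy]
  rw [mvfderiv_apply_congr hconst, mvfderiv_const, hL ((hφ hx).mdifferentiableAt (by simp))] at h
  refine h.trans ?_
  have hv : MDifferentiableAt (𝓡 n) 𝓘(ℝ, EuclideanSpace ℝ (Fin n))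
      (fun y => mvfderiv (𝓡 n) (extChartAt (𝓡 n) x) y (v y)) x := by
    have h1 := ((Bundle.contMDiffAt_section (s := fun y => v y) x).1
      (v.contMDiff x)).mdifferentiableAt (by simp)
    refine h1.congr_of_eventuallyEq ?_
    filter_upwards [hsrc] with y hy
    rw [← chartDeriv_eq_mvfderiv hy]
    exact congr($(Bundle.Trivialization.coe_linearMapAt_of_mem _ (mem_baseSet_iff.2 hy)) (v y))
  have hv2 : (fun y => mvfderiv (𝓡 n) (fun z => extChartAt (𝓡 n) x z j) y (v y)) =ᶠ[𝓝 x]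
      fun y => mvfderiv (𝓡 n) (extChartAt (𝓡 n) x) y (v y) j := by
    filter_upwards [hsrc] with y hy
    rw [hL ((hφ hy).mdifferentiableAt (by simp))]
  rw [mvfderiv_apply_congr hv2, hL hv]
  simp

/-- The derivative of the Jacobian along a curve through the identity is the divergence. In the
chart at `x` both sides are computed in the coordinate frame: the derivative of the differential of
`F s` is the derivative of the coordinates of `v`, which the brackets of `v` with the frame fields
contribute to the Lie derivative of the volume form. -/
theorem IsCurve.hasDerivAt_jacobian [T2Space X] (vol : VolumeForm n X) {F : ℝ → Diffeo n X}
    {v : VField n X} (hF : IsCurve F v) (x : X) :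
    HasDerivAt (fun s => (volQuot (vol.pull (F s)) vol).fn x) (divergence vol v x) 0 := by
  have hx := mem_chart_source (EuclideanSpace ℝ (Fin n)) x
  have hsrc := chart_source_mem_nhds (n := n) x
  let g : X → ℝ := fun y => vol.form.1 y (fun i => coordFrame x i y)
  let A : Fin n → ℝ → EuclideanSpace ℝ (Fin n) := fun i s =>
    chartDeriv x (F s x) (mfderiv (𝓡 n) (𝓡 n) (F s) x (coordFrame x i x))
  have hsn (i : Fin n) := coordFrame_smoothNear x i hx
  have hgd := hF.hasDerivAt_comp (form_mdiff vol.form hsn)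
  have hFc : ∀ᶠ s in 𝓝 (0 : ℝ), F s x ∈ (chartAt (EuclideanSpace ℝ (Fin n)) x).source := by
    have hc : ContinuousAt (fun s : ℝ => F s x) 0 :=
      (hF.smooth.continuous.comp (Continuous.prodMk_left x)).continuousAt
    refine hc.eventually ?_
    beta_reduce
    rw [hF.apply_zero x]
    exact hsrc
  have hφ {y : X} (hy : y ∈ (chartAt (EuclideanSpace ℝ (Fin n)) x).source) :
      ContMDiffAt (𝓡 n) 𝓘(ℝ, EuclideanSpace ℝ (Fin n)) ∞ (extChartAt (𝓡 n) x) y :=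
    contMDiffAt_extChartAt' hy
  have hA (i : Fin n) : HasDerivAt (A i)
      (-chartDeriv x x (mlieBracket (𝓡 n) (fun y => v y) (coordFrame x i) x)) 0 := by
    have h1 : ContMDiffAt (𝓘(ℝ, ℝ).prod (𝓡 n)) 𝓘(ℝ, EuclideanSpace ℝ (Fin n)) ∞
        (fun p : ℝ × X => extChartAt (𝓡 n) x (F p.1 p.2)) (0, x) :=
      ContMDiffAt.comp (0, x) (hφ (by rw [hF.apply_zero]; exact hx)) hF.smooth.contMDiffAt
    have h2 := hasDerivAt_mvfderiv_family (h := fun s y => extChartAt (𝓡 n) x (F s y)) h1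
      (coordFrame x i x)
    have h3 : (fun y => deriv (fun s => extChartAt (𝓡 n) x (F s y)) 0) =ᶠ[𝓝 x]
        fun y => mvfderiv (𝓡 n) (extChartAt (𝓡 n) x) y (v y) := by
      filter_upwards [hsrc] with y hy
      exact (hF.hasDerivAt_comp ((hφ hy).mdifferentiableAt (by simp))).deriv
    rw [mvfderiv_apply_congr h3] at h2
    rw [chartDeriv_mlieBracket_coordFrame, neg_neg]
    refine h2.congr_of_eventuallyEq ?_
    filter_upwards [hFc] with s hs
    change chartDeriv x (F s x) _ = _
    rw [chartDeriv_eq_mvfderiv hs]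
    have h4 := mfderiv_comp x ((hφ hs).mdifferentiableAt (by simp))
      ((F s).mdifferentiable (by simp) x)
    exact congr($h4.symm (coordFrame x i x))
  have hA0 (i : Fin n) : A i 0 = EuclideanSpace.basisFun (Fin n) ℝ i := by
    have h1 : A i 0 = chartDeriv x x (mfderiv (𝓡 n) (𝓡 n) (id : X → X) x (coordFrame x i x)) := by
      change chartDeriv x (F 0 x) (mfderiv (𝓡 n) (𝓡 n) (F 0) x (coordFrame x i x)) = _
      rw [hF.zero]
      rfl
    rw [h1, mfderiv_id]
    exact chartDeriv_coordFrame i hx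
  -- At time `0` the matrix `A` is the identity, so the derivative of its determinant is the sum of
  -- the terms in which one basis vector is replaced by the derivative of the corresponding column.
  have hD := (HasFDerivAt.multilinear_comp (detMap n)
    fun i => (hA i).hasFDerivAt).hasDerivAt
  have hJ : (fun s => (volQuot (vol.pull (F s)) vol).fn x) =ᶠ[𝓝 0]
      fun s => g (F s x) * detMap n (fun i => A i s) / g x := by
    filter_upwards [hFc] with s hs using jacobian_eq vol (F s) hx hs
  refine (((hgd.mul hD).div_const (g x)).congr_of_eventuallyEq hJ).congr_deriv ?_
  rw [divergence, topQuot_apply_coordFrame _ vol hx, lieDeriv_apply v _ hsn, lieExpr]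
  have hA0' : (fun i => A i 0) = fun i => EuclideanSpace.basisFun (Fin n) ℝ i := funext hA0
  have hterm (i : Fin n) : vol.form.1 x (Function.update (fun j => coordFrame x j x) i
      (mlieBracket (𝓡 n) (fun y => v y) (coordFrame x i) x)) =
      g x * detMap n (Function.update (fun i => EuclideanSpace.basisFun (Fin n) ℝ i) i
        (chartDeriv x x (mlieBracket (𝓡 n) (fun y => v y) (coordFrame x i) x))) := by
    rw [top_apply_eq_detMap hx]
    congr 2
    funext j
    by_cases hj : j = i
    · subst hj; simp
    · simp only [Function.update_of_ne hj, chartDeriv_coordFrame j hx]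
  simp only [hterm, ← Finset.mul_sum]
  rw [hA0', detMap_basis, hF.apply_zero]
  have hneg (i : Fin n) (e : EuclideanSpace ℝ (Fin n)) :
      detMap n (Function.update (fun i => EuclideanSpace.basisFun (Fin n) ℝ i) i (-e)) =
        -detMap n (Function.update (fun i => EuclideanSpace.basisFun (Fin n) ℝ i) i e) :=
    (detMap n).toMultilinearMap.map_update_neg _ i e
  simp only [sum_apply, ContinuousLinearMap.comp_apply,
    ContinuousLinearMap.toSpanSingleton_apply, one_smul,
    ContinuousMultilinearMap.toContinuousLinearMap_apply, hneg, Finset.sum_neg_distrib]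
  change (_ * 1 + g x * _) / g x = (_ - g x * _) / g x
  ring

/-! ### The mixed derivative of the group cocycle -/

theorem jacobian_refl (vol : VolumeForm n X) (x : X) :
    (volQuot (vol.pull (Diffeomorph.refl (𝓡 n) X ∞)) vol).fn x = 1 := by
  have h : (vol.pull (Diffeomorph.refl (𝓡 n) X ∞)).form = fnSmul 1 vol.form := by
    refine Form.ext' fun y ξ => ?_
    have h1 : mfderiv (𝓡 n) (𝓡 n) (Diffeomorph.refl (𝓡 n) X ∞) y =
        ContinuousLinearMap.id ℝ (TangentSpace (𝓡 n) y) := mfderiv_id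
    change vol.form.1 y (fun i => mfderiv (𝓡 n) (𝓡 n) (Diffeomorph.refl (𝓡 n) X ∞) y (ξ i)) =
      1 * vol.form.1 y ξ
    rw [h1, one_mul]
    rfl
  exact congr($(topQuot_eq h) x)

theorem logJac_refl (vol : VolumeForm n X) : logJac vol (Diffeomorph.refl (𝓡 n) X ∞) = 0 := by
  ext x
  change Real.log |(volQuot (vol.pull (Diffeomorph.refl (𝓡 n) X ∞)) vol).fn x| = 0
  rw [jacobian_refl, abs_one, Real.log_one]

theorem IsCurve.hasDerivAt_logJac [T2Space X] (vol : VolumeForm n X) {F : ℝ → Diffeo n X}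
    {v : VField n X} (hF : IsCurve F v) (x : X) :
    HasDerivAt (fun s => logJac vol (F s) x) (divergence vol v x) 0 := by
  have h := (hF.hasDerivAt_jacobian vol x).log ((volQuot (vol.pull (F 0)) vol).ne_zero x)
  have h0 : (volQuot (vol.pull (F 0)) vol).fn x = 1 := by rw [hF.zero, jacobian_refl]
  rw [h0, div_one] at h
  refine h.congr_of_eventuallyEq (Filter.Eventually.of_forall fun s => ?_)
  exact Real.log_abs _

theorem IsCurve.mvfderiv_logJac_zero (vol : VolumeForm n X) {F : ℝ → Diffeo n X}
    {v : VField n X} (hF : IsCurve F v) (x : X) (ξ : TangentSpace (𝓡 n) x) :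
    mvfderiv (𝓡 n) (logJac vol (F 0)) x ξ = 0 := by
  rw [hF.zero, logJac_refl, ContMDiffMap.coe_zero, mvfderiv_zero]
  rfl

theorem IsCurve.hasDerivAt_mvfderiv_logJac [T2Space X] (vol : VolumeForm n X)
    {F : ℝ → Diffeo n X} {v : VField n X} (hF : IsCurve F v) (x : X)
    (ξ : TangentSpace (𝓡 n) x) :
    HasDerivAt (fun s => mvfderiv (𝓡 n) (logJac vol (F s)) x ξ)
      (mvfderiv (𝓡 n) (divergence vol v) x ξ) 0 := by
  have h := hasDerivAt_mvfderiv_family (h := fun s y => logJac vol (F s) y)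
    ((contMDiff_logJac vol hF.smooth).contMDiffAt (x := (0, x))) ξ
  have h1 : (fun y => deriv (fun s => logJac vol (F s) y) 0) = divergence vol v :=
    funext fun y => (hF.hasDerivAt_logJac vol y).deriv
  rwa [h1] at h

/-- At `t = 0` the factor `d ln |ω(G_t) / ω|` vanishes, so the derivative of the first factor
`ln |ω(F G_t) / ω(G_t)|` does not contribute. -/
theorem IsCurve.hasDerivAt_cocycleForm_right [T2Space X] (vol : VolumeForm n X)
    (F : Diffeo n X) {G : ℝ → Diffeo n X} {w : VField n X} (hG : IsCurve G w) (x : X)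
    (ξ : Fin 1 → TangentSpace (𝓡 n) x) :
    HasDerivAt (fun t => (cocycleForm vol F (G t)).1 x ξ)
      (logJac vol F x * mvfderiv (𝓡 n) (divergence vol w) x (ξ 0)) 0 := by
  refine ((hG.hasDerivAt_comp ((logJac vol F).mdifferentiableAt (x := x))).mul
    (hG.hasDerivAt_mvfderiv_logJac vol x (ξ 0))).congr_deriv ?_
  rw [hG.mvfderiv_logJac_zero, mul_zero, zero_add, hG.apply_zero]

theorem IsCurve.hasDerivAt_cocycleForm_left [T2Space X] (vol : VolumeForm n X)
    {F : ℝ → Diffeo n X} {v : VField n X} (hF : IsCurve F v) (G : Diffeo n X) (x : X)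
    (ξ : Fin 1 → TangentSpace (𝓡 n) x) :
    HasDerivAt (fun s => (cocycleForm vol (F s) G).1 x ξ)
      (divergence vol v (G x) * mvfderiv (𝓡 n) (logJac vol G) x (ξ 0)) 0 :=
  (hF.hasDerivAt_logJac vol (G x)).mul_const _

theorem hasDerivAt_deriv_cocycleForm [T2Space X] (vol : VolumeForm n X) {F G : ℝ → Diffeo n X}
    {v w : VField n X} (hF : IsCurve F v) (hG : IsCurve G w) (x : X)
    (ξ : Fin 1 → TangentSpace (𝓡 n) x) :
    HasDerivAt (fun s => deriv (fun t => (cocycleForm vol (F s) (G t)).1 x ξ) 0)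
      ((fnSmul (divergence vol v) (diff (divergence vol w))).1 x ξ) 0 := by
  simp only [(hG.hasDerivAt_cocycleForm_right vol _ x ξ).deriv]
  exact (hF.hasDerivAt_logJac vol x).mul_const _

theorem hasDerivAt_deriv_cocycleForm_swap [T2Space X] (vol : VolumeForm n X)
    {F G : ℝ → Diffeo n X} {v w : VField n X} (hF : IsCurve F v) (hG : IsCurve G w) (x : X)
    (ξ : Fin 1 → TangentSpace (𝓡 n) x) :
    HasDerivAt (fun s => deriv (fun t => (cocycleForm vol (G t) (F s)).1 x ξ) 0)
      ((fnSmul (divergence vol w) (diff (divergence vol v))).1 x ξ) 0 := by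
  simp only [(hG.hasDerivAt_cocycleForm_left vol _ x ξ).deriv]
  refine ((hF.hasDerivAt_comp ((divergence vol w).mdifferentiableAt (x := x))).mul
    (hF.hasDerivAt_mvfderiv_logJac vol x (ξ 0))).congr_deriv ?_
  rw [hF.mvfderiv_logJac_zero, mul_zero, zero_add, hF.apply_zero]
  rfl

theorem IsSmoothFamily.swap {β : ℝ → ℝ → Form n X 1} (h : IsSmoothFamily β) :
    IsSmoothFamily fun s t => β t s := by
  intro s t x w hw
  have h1 : ContMDiff ((𝓘(ℝ, ℝ).prod 𝓘(ℝ, ℝ)).prod (𝓡 n))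
      ((𝓘(ℝ, ℝ).prod 𝓘(ℝ, ℝ)).prod (𝓡 n)) ∞
      (fun p : (ℝ × ℝ) × X => ((p.1.2, p.1.1), p.2)) :=
    ((contMDiff_snd.comp contMDiff_fst).prodMk (contMDiff_fst.comp contMDiff_fst)).prodMk
      contMDiff_snd
  exact ContMDiffAt.comp ((s, t), x) (h t s x w hw) h1.contMDiffAt

omit [IsManifold (𝓡 n) ∞ X] in
theorem contMDiffAt_comp_mul_family {a b : ℝ × X → ℝ} {g : ℝ × X → X} {s t : ℝ} {x : X}
    (ha : ContMDiff (𝓘(ℝ, ℝ).prod (𝓡 n)) 𝓘(ℝ, ℝ) ∞ a)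
    (hg : ContMDiff (𝓘(ℝ, ℝ).prod (𝓡 n)) (𝓡 n) ∞ g)
    (hb : ContMDiffAt (𝓘(ℝ, ℝ).prod (𝓡 n)) 𝓘(ℝ, ℝ) ∞ b (t, x)) :
    ContMDiffAt ((𝓘(ℝ, ℝ).prod 𝓘(ℝ, ℝ)).prod (𝓡 n)) 𝓘(ℝ, ℝ) ∞
      (fun p : (ℝ × ℝ) × X => a (p.1.1, g (p.1.2, p.2)) * b (p.1.2, p.2)) ((s, t), x) := by
  have h0 : ContMDiff ((𝓘(ℝ, ℝ).prod 𝓘(ℝ, ℝ)).prod (𝓡 n)) (𝓘(ℝ, ℝ).prod (𝓡 n)) ∞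
      (fun p : (ℝ × ℝ) × X => (p.1.2, p.2)) :=
    (contMDiff_snd.comp contMDiff_fst).prodMk contMDiff_snd
  have h1 : ContMDiff ((𝓘(ℝ, ℝ).prod 𝓘(ℝ, ℝ)).prod (𝓡 n)) 𝓘(ℝ, ℝ) ∞
      (fun p : (ℝ × ℝ) × X => a (p.1.1, g (p.1.2, p.2))) :=
    ha.comp ((contMDiff_fst.comp contMDiff_fst).prodMk (hg.comp h0))
  exact h1.contMDiffAt.mul (ContMDiffAt.comp ((s, t), x) hb h0.contMDiffAt)

theorem isSmoothFamily_cocycleForm (vol : VolumeForm n X) {F G : ℝ → Diffeo n X}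
    {v w : VField n X} (hF : IsCurve F v) (hG : IsCurve G w) :
    IsSmoothFamily fun s t => cocycleForm vol (F s) (G t) := by
  intro s t x u hu
  have hb := contMDiffAt_mvfderiv_family (h := fun r y => logJac vol (G r) y) (s := t)
    (contMDiff_logJac vol hG.smooth) (hu 0)
  have ha := contMDiff_logJac vol hF.smooth
  have hg := hG.smooth
  have h := contMDiffAt_comp_mul_family (s := s) ha hg hb
  exact h

theorem IsSmoothFamily.const_smul_sub {β β' : ℝ → ℝ → Form n X 1} (h : IsSmoothFamily β)
    (h' : IsSmoothFamily β') (c : ℝ) : IsSmoothFamily fun s t => c • (β s t - β' s t) :=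
  fun s t x w hw => contMDiffAt_const.mul ((h s t x w hw).sub (h' s t x w hw))

theorem hasMixedDeriv_groupCocycle [T2Space X] (vol : VolumeForm n X) {F G : ℝ → Diffeo n X}
    {v w : VField n X} (hF : IsCurve F v) (hG : IsCurve G w) :
    HasMixedDeriv (fun s t => groupCocycle vol (F s) (G t)) (lieCocycle vol v w) :=
  ⟨fun s t => cocycleForm vol (F s) (G t), isSmoothFamily_cocycleForm vol hF hG,
    fun s t => (groupCocycle_eq vol (F s) (G t)).symm, _, rfl,
    fun x ξ => (hasDerivAt_deriv_cocycleForm vol hF hG x ξ).deriv⟩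

theorem corresponds_groupCocycle [T2Space X] (vol : VolumeForm n X) :
    Corresponds (groupCocycle vol) (lieCocycle vol) := by
  intro v w F G hF hG
  refine ⟨fun s t => (1 / 2 : ℝ) • (cocycleForm vol (F s) (G t) - cocycleForm vol (G t) (F s)),
    (isSmoothFamily_cocycleForm vol hF hG).const_smul_sub
      (isSmoothFamily_cocycleForm vol hG hF).swap _, fun s t => ?_,
    (1 / 2 : ℝ) • (fnSmul (divergence vol v) (diff (divergence vol w)) -
      fnSmul (divergence vol w) (diff (divergence vol v))), ?_, fun x ξ => ?_⟩
  · beta_reduce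
    rw [groupCocycle_eq, groupCocycle_eq, map_smul, map_sub]
  · rw [map_smul, map_sub, cls_fnSmul_diff_swap (divergence vol w), sub_neg_eq_add, ← two_smul ℝ,
      smul_smul]
    norm_num
    rfl
  · have h (s : ℝ) : deriv (fun t => ((1 / 2 : ℝ) • (cocycleForm vol (F s) (G t) -
          cocycleForm vol (G t) (F s))).1 x ξ) 0 =
        1 / 2 * (deriv (fun t => (cocycleForm vol (F s) (G t)).1 x ξ) 0 -
          deriv (fun t => (cocycleForm vol (G t) (F s)).1 x ξ) 0) :=
      (((hG.hasDerivAt_cocycleForm_right vol (F s) x ξ).differentiableAt.hasDerivAt.sub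
        (hG.hasDerivAt_cocycleForm_left vol (F s) x ξ).differentiableAt.hasDerivAt).const_mul
          (1 / 2 : ℝ)).deriv
    simp only [h]
    exact (((hasDerivAt_deriv_cocycleForm vol hF hG x ξ).sub
      (hasDerivAt_deriv_cocycleForm_swap vol hF hG x ξ)).const_mul (1 / 2 : ℝ)).deriv

end VolumeManifold

end

/-- Let `ω` be a volume form on a smooth manifold `X`. -/
theorem corollary4p2 {n : ℕ} {X : Type*} [TopologicalSpace X] [T2Space X]
    [SecondCountableTopology X] [ChartedSpace (EuclideanSpace ℝ (Fin n)) X]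
    [IsManifold (𝓡 n) ∞ X] (vol : VolumeManifold.VolumeForm n X) :
    VolumeManifold.IsGroupCocycle (VolumeManifold.groupCocycle vol) ∧
    VolumeManifold.IsLieCocycle (VolumeManifold.lieCocycle vol) ∧
    VolumeManifold.Corresponds (VolumeManifold.groupCocycle vol) (VolumeManifold.lieCocycle vol) ∧
    ∀ (v w : VolumeManifold.VField n X) (F G : ℝ → VolumeManifold.Diffeo n X),
      VolumeManifold.IsCurve F v → VolumeManifold.IsCurve G w →
      VolumeManifold.HasMixedDeriv (fun s t => VolumeManifold.groupCocycle vol (F s) (G t))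
        (VolumeManifold.lieCocycle vol v w) := by
  exact ⟨VolumeManifold.isGroupCocycle_groupCocycle vol,
    VolumeManifold.isLieCocycle_lieCocycle vol, VolumeManifold.corresponds_groupCocycle vol,
    fun _ _ _ _ hF hG => VolumeManifold.hasMixedDeriv_groupCocycle vol hF hG⟩
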